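/- All operads are coloured symmetric operads in sets. Operadic terms are written as operations applied to inputs $x,y,z,\dots$ (each input occurring exactly once), so that an equality of terms expresses a relation between operadic composites up to the evident permutation of inputs. * $\mathsf{Op}$ is the $\mathbb N$-coloured operad generated by $\eta\in\mathsf{Op}(\,;1)$ and, for all $n\ge 0$ and $q_1,\dots,q_n\in\mathbb N$, an element $C_{q_1,\dots,q_n}\in\mathsf{Op}(n,q_1,\dots,q_n;\sum_i q_i)$, subject to $$C(C(x;y_1,\dots,y_n);z^1_1,\dots,z^n_{m_n})=C\bigl(x;C(y_1;z^1_1,\dots,z^1_{m_1}),\dots,C(y_n;z^n_1,\dots,z^n_{m_n})\bigr),\qquad C(\eta;x)=x=C(x;\eta,\dots,\eta)$$ for all inputs of matching colours. * $\mathsf{Pro}$ is the $\mathbb N^2$-coloured operad generated by $M_{p,r,t}\in\mathsf{Pro}((p,r),(r,t);(p,t))$, $P_{p,r}^{p',r'}\in\mathsf{Pro}((p,r),(p',r');(p+p',r+r'))$, $\eta_P\in\mathsf{Pro}(\,;(0,0))$ and $\eta_M\in\mathsf{Pro}(\,;(1,1))$, subject to associativity of $M$ and of $P$, the interchange law $M(P(x,x'),P(y,y'))=P(M(x,y),M(x',y'))$,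 and the unit laws $P(x,\eta_P)=x=P(\eta_P,x)$ and $M(x,\eta_M^r)=x=M(\eta_M^p,x)$ for $x$ of colour $(p,r)$, where $\eta_M^r$ is the $r$-fold $P$-product of $\eta_M$ (with $\eta_M^0=\eta_P$). Its algebras are pros. * $\square\mathsf p$ is the $\mathbb N^3$-coloured operad generated by $\eta\in\square\mathsf p(\,;(0,1,0))$ and, for all $n\ge 0$ and $q_1,\dots,q_n,p_0,\dots,p_n,p,r\in\mathbb N$, an element $$C^{p_0,\dots,p_n;p,r}_{q_1,\dots,q_n}\in\square\mathsf p\bigl((p,n,r),(p_0,q_1,p_1),\dots,(p_{n-1},q_n,p_n);(p+p_0,\textstyle\sum_i q_i,r+p_n)\bigr),$$ subject to the same associativity and unit relations as for $\mathsf{Op}$, for all inputs of matching colours. Explicitly, let $x$ have colour $(p,n,r)$, let $y_i$ have colour $(p_{i-1},m_i,p_i)$, and let the $z^1_1,\dots,z^n_{m_n}$, written as one sequence $z_1,\dots,z_N$ with $N=\sum_i m_i$, have colours $(s_{k-1},q_k,s_k)$, where $s_0,\dots,s_N\in\mathbb N$. With $o_i=m_1+\dots+m_i$, the left-hand side of associativity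 is $C^{s_0,\dots,s_N;\,p+p_0,\,r+p_n}(C^{p_0,\dots,p_n;p,r}(x;y_1,\dots,y_n);z_1,\dots,z_N)$. On the right-hand side the inner generators are $C^{s_{o_{i-1}},\dots,s_{o_i};\,p_{i-1},\,p_i}$ and the outer one is $C^{p_0+s_{o_0},\dots,p_n+s_{o_n};\,p,\,r}$. The unit relations are $C_n^{p,r;0,0}(\eta;x)=x=C_{1,\dots,1}^{0,\dots,0;p,r}(x;\eta,\dots,\eta)$ for $x$ of colour $(p,n,r)$. * $\mathbb V:\square\mathsf p\to\mathsf{Op}$ is the morphism of coloured symmetric operads given on colours by $(p,q,r)\mapsto q$ and on generators by $C^{p_0,\dots,p_n;p,r}_{q_1,\dots,q_n}\mapsto C_{q_1,\dots,q_n}$, $\eta\mapsto\eta$. * $\mathbb H:\square\mathsf p\to\mathsf{Pro}$ is the morphism of coloured symmetric operads given on colours by $(p,q,r)\mapsto(p,r)$ and on generators by $C^{p_0,\dots,p_n;p,r}_{q_1,\dots,q_n}(x;y_1,\dots,y_n)\mapsto P_{p,r}^{p_0,p_n}\bigl(x,M(\dots M(M(y_1,y_2),y_3)\dots,y_n)\bigr)$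 and $\eta\mapsto\eta_P$, where the iterated $M$ is $y_1$ if $n=1$ and $\eta_M^{p_0}$ if $n=0$. **Theorem.** The morphism $(\mathbb V,\mathbb H):\square\mathsf p\to\mathsf{Op}\times\mathsf{Pro}$, where the product is coloured by $\mathbb N\times\mathbb N^2$, is injective, both on colours and on every set of operations with given input and output colours. Hence it identifies $\square\mathsf p$ with a suboperad of $\mathsf{Op}\times\mathsf{Pro}$: there is a suboperad $U$ of $\mathsf{Op}\times\mathsf{Pro}$ such that $(\mathbb V,\mathbb H)$ is bijective on colours and restricts to a bijection from the operations of $\square\mathsf p$ onto those of $U$ of the corresponding colours. -/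

import Mathlib

/-- A coloured symmetric operad in sets with colours `C`, in coordinate-free form: for every finite
set `ι` of inputs, coloured by `c`, and every output colour `d` there is a set of operations
`Hom ι c d`. For `ι = Fin n` this is the usual set `P(c₁, …, cₙ; d)`. Bijections of the input set
act by `map` (for `ι = ι' = Fin n`, the action of the symmetric group), `one` is the operadic unit
and `comp` is the total composition `f ∘ (x₁, …, xₙ)`. The remaining fields are functoriality and
equivariance, the unit laws and associativity. -/
structure ColOperad (C : Type) where
  Hom : (ι : Type) → [Finite ι] → (ι → C) → C → Type
  one : ∀ d : C, Hom Unit (fun _ => d) d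
  map : ∀ {ι ι' : Type} [Finite ι] [Finite ι'] (e : ι ≃ ι') {c : ι' → C} {d : C},
    Hom ι (fun i => c (e i)) d → Hom ι' c d
  comp : ∀ {ι : Type} [Finite ι] {κ : ι → Type} [∀ i, Finite (κ i)] {c : ι → C}
    {k : ∀ i, κ i → C} {d : C}, Hom ι c d → (∀ i, Hom (κ i) (k i) (c i)) →
    Hom (Σ i, κ i) (fun y => k y.1 y.2) d
  map_refl : ∀ {ι : Type} [Finite ι] {c : ι → C} {d : C} (f : Hom ι c d),
    map (Equiv.refl ι) f = f
  map_trans : ∀ {ι ι' ι'' : Type} [Finite ι] [Finite ι'] [Finite ι''] (e : ι ≃ ι') (e' : ι' ≃ ι'')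
    {c : ι'' → C} {d : C} (f : Hom ι (fun i => c (e' (e i))) d),
    map (e.trans e') f = map e' (map (c := fun i => c (e' i)) e f)
  map_comp_left : ∀ {ι ι' : Type} [Finite ι] [Finite ι'] (e : ι ≃ ι') {κ : ι' → Type}
    [∀ i, Finite (κ i)] {c : ι' → C} {k : ∀ i, κ i → C} {d : C}
    (f : Hom ι (fun i => c (e i)) d) (x : ∀ i, Hom (κ i) (k i) (c i)),
    comp (map e f) x = map (c := fun y => k y.1 y.2) (Equiv.sigmaCongrLeft e)
      (comp f (fun i => x (e i)))
  map_comp_right : ∀ {ι : Type} [Finite ι] {κ κ' : ι → Type} [∀ i, Finite (κ i)]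
    [∀ i, Finite (κ' i)] (e : ∀ i, κ i ≃ κ' i) {c : ι → C} {k : ∀ i, κ' i → C} {d : C}
    (f : Hom ι c d) (x : ∀ i, Hom (κ i) (fun j => k i (e i j)) (c i)),
    comp f (fun i => map (e i) (x i)) =
      map (c := fun y => k y.1 y.2) (Equiv.sigmaCongrRight e) (comp f x)
  one_comp : ∀ {κ : Type} [Finite κ] {k : κ → C} {d : C} (x : Hom κ k d),
    comp (one d) (fun _ => x) =
      map (c := fun y : (Σ _ : Unit, κ) => k y.2) (Equiv.uniqueSigma fun _ : Unit => κ).symm x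
  comp_one : ∀ {ι : Type} [Finite ι] {c : ι → C} {d : C} (f : Hom ι c d),
    comp f (fun i => one (c i)) =
      map (c := fun y : (Σ _ : ι, Unit) => c y.1) (Equiv.sigmaUnique ι fun _ => Unit).symm f
  assoc : ∀ {ι : Type} [Finite ι] {κ : ι → Type} [∀ i, Finite (κ i)]
    {μ : ∀ i, κ i → Type} [∀ i j, Finite (μ i j)] {c : ι → C} {k : ∀ i, κ i → C}
    {l : ∀ i j, μ i j → C} {d : C} (f : Hom ι c d) (x : ∀ i, Hom (κ i) (k i) (c i))
    (y : ∀ i j, Hom (μ i j) (l i j) (k i j)),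
    map (c := fun z : (Σ i, Σ j, μ i j) => l z.1 z.2.1 z.2.2) (Equiv.sigmaAssoc μ)
      (comp (comp f x) (fun ij => y ij.1 ij.2)) = comp f (fun i => comp (x i) (y i))

namespace ColOperad

/-- A morphism of coloured symmetric operads over a map of colours. -/
structure Morphism {C D : Type} (P : ColOperad C) (Q : ColOperad D) where
  colour : C → D
  app : ∀ {ι : Type} [Finite ι] {c : ι → C} {d : C},
    P.Hom ι c d → Q.Hom ι (fun i => colour (c i)) (colour d)
  app_one : ∀ d : C, app (P.one d) = Q.one (colour d)
  app_map : ∀ {ι ι' : Type} [Finite ι] [Finite ι'] (e : ι ≃ ι') {c : ι' → C} {d : C}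
    (f : P.Hom ι (fun i => c (e i)) d),
    app (P.map e f) = Q.map (c := fun i => colour (c i)) e (app f)
  app_comp : ∀ {ι : Type} [Finite ι] {κ : ι → Type} [∀ i, Finite (κ i)] {c : ι → C}
    {k : ∀ i, κ i → C} {d : C} (f : P.Hom ι c d) (x : ∀ i, P.Hom (κ i) (k i) (c i)),
    app (P.comp f x) = Q.comp (k := fun i j => colour (k i j)) (app f) (fun i => app (x i))

/-- The product of a `C`-coloured and a `D`-coloured operad, with colours `C × D`. -/
def prod {C D : Type} (P : ColOperad C) (Q : ColOperad D) : ColOperad (C × D) where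
  Hom ι _ c d := P.Hom ι (fun i => (c i).1) d.1 × Q.Hom ι (fun i => (c i).2) d.2
  one d := (P.one d.1, Q.one d.2)
  map e _ _ f := (P.map e f.1, Q.map e f.2)
  comp f x := (P.comp f.1 fun i => (x i).1, Q.comp f.2 fun i => (x i).2)
  map_refl f := Prod.ext (P.map_refl f.1) (Q.map_refl f.2)
  map_trans e e' c _ f := Prod.ext (P.map_trans e e' (c := fun i => (c i).1) f.1)
    (Q.map_trans e e' (c := fun i => (c i).2) f.2)
  map_comp_left e _ _ c k _ f x :=
    Prod.ext (P.map_comp_left e (c := fun i => (c i).1) (k := fun i j => (k i j).1)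
        f.1 fun i => (x i).1)
      (Q.map_comp_left e (c := fun i => (c i).2) (k := fun i j => (k i j).2)
        f.2 fun i => (x i).2)
  map_comp_right e _ k _ f x :=
    Prod.ext (P.map_comp_right e (k := fun i j => (k i j).1) f.1 fun i => (x i).1)
      (Q.map_comp_right e (k := fun i j => (k i j).2) f.2 fun i => (x i).2)
  one_comp x := Prod.ext (P.one_comp x.1) (Q.one_comp x.2)
  comp_one f := Prod.ext (P.comp_one f.1) (Q.comp_one f.2)
  assoc f x y := Prod.ext (P.assoc f.1 (fun i => (x i).1) fun i j => (y i j).1)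
    (Q.assoc f.2 (fun i => (x i).2) fun i j => (y i j).2)

/-- The morphism `(F, G)` into the product. -/
def Morphism.prod {B C D : Type} {P : ColOperad B} {Q : ColOperad C} {R : ColOperad D}
    (F : Morphism P Q) (G : Morphism P R) : Morphism P (Q.prod R) where
  colour b := (F.colour b, G.colour b)
  app {ι} _ c d f := show Q.Hom ι (fun i => F.colour (c i)) (F.colour d) ×
    R.Hom ι (fun i => G.colour (c i)) (G.colour d) from (F.app f, G.app f)
  app_one d := Prod.ext (F.app_one d) (G.app_one d)
  app_map e _ _ f := Prod.ext (F.app_map e f) (G.app_map e f)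
  app_comp f x := Prod.ext (F.app_comp f x) (G.app_comp f x)

/-- Injectivity on colours and on all sets of operations. -/
def Morphism.IsInjective {C D : Type} {P : ColOperad C} {Q : ColOperad D}
    (F : Morphism P Q) : Prop :=
  Function.Injective F.colour ∧ ∀ (ι : Type) [Finite ι] (c : ι → C) (d : C),
    Function.Injective (F.app : P.Hom ι c d → _)

/-- A suboperad (on all colours): subsets of operations closed under the operad structure. -/
structure Suboperad {C : Type} (P : ColOperad C) where
  carrier : ∀ {ι : Type} [Finite ι] {c : ι → C} {d : C}, Set (P.Hom ι c d)
  one_mem : ∀ d : C, P.one d ∈ carrier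
  map_mem : ∀ {ι ι' : Type} [Finite ι] [Finite ι'] (e : ι ≃ ι') {c : ι' → C} {d : C}
    (f : P.Hom ι (fun i => c (e i)) d), f ∈ carrier → P.map e f ∈ carrier
  comp_mem : ∀ {ι : Type} [Finite ι] {κ : ι → Type} [∀ i, Finite (κ i)] {c : ι → C}
    {k : ∀ i, κ i → C} {d : C} (f : P.Hom ι c d) (x : ∀ i, P.Hom (κ i) (k i) (c i)),
    f ∈ carrier → (∀ i, x i ∈ carrier) → P.comp f x ∈ carrier

/-- `F` is an isomorphism of operads onto the suboperad `U`: it is bijective on colours, and on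
operations it is a bijection onto those of `U`. -/
def Morphism.IsIsoOnto {C D : Type} {P : ColOperad C} {Q : ColOperad D} (F : Morphism P Q)
    (U : Suboperad Q) : Prop :=
  Function.Bijective F.colour ∧ ∀ (ι : Type) [Finite ι] (c : ι → C) (d : C),
    Set.BijOn (F.app : P.Hom ι c d → _) Set.univ U.carrier

end ColOperad

/-- A set of coloured generators `g`, with finite input set `Ar g`, input colours and output colour. -/
structure Sig (C : Type) where
  Op : Type
  Ar : Op → Type
  fin : ∀ g, Fintype (Ar g)
  inp : ∀ g, Ar g → C
  out : Op → C

attribute [instance] Sig.fin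

/-- Trees of generators: terms of output colour `d` in variables `i : ι` of colours `c i`. The
colours match up to a proof of equality, so that no transport is needed. -/
inductive Tm {C : Type} (S : Sig C) (ι : Type) (c : ι → C) : C → Type
  | var {d : C} (i : ι) (h : c i = d) : Tm S ι c d
  | op {d : C} (g : S.Op) (args : ∀ j, Tm S ι c (S.inp g j)) (h : S.out g = d) : Tm S ι c d

namespace Tm

variable {C D : Type} {S : Sig C} {S' : Sig D} {ι κ μ : Type} {c : ι → C} {k : κ → C} {l : μ → C}

/-- The variables of a term, with multiplicity. -/
def vars {d : C} : Tm S ι c d → Multiset ι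
  | var i _ => {i}
  | op _ args _ => ∑ j, (args j).vars

/-- Every variable occurs exactly once. The linear terms in the variables `ι` are the trees of
generators with inputs labelled bijectively by `ι`: the operations of the free operad. -/
def Linear {d : C} (t : Tm S ι c d) : Prop := t.vars.Nodup ∧ ∀ i, i ∈ t.vars

/-- Change of the output colour along an equality. -/
def cast {d d' : C} (h : d = d') : Tm S ι c d → Tm S ι c d'
  | var i h' => var i (h'.trans h)
  | op g args h' => op g args (h'.trans h)

/-- Substitution of terms for the variables (grafting of trees). -/
def subst {d : C} : Tm S ι c d → (∀ i, Tm S κ k (c i)) → Tm S κ k d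
  | var i h, s => (s i).cast h
  | op g args h, s => op g (fun j => (args j).subst s) h

@[simp] theorem cast_rfl {d : C} (t : Tm S ι c d) : t.cast rfl = t := by cases t <;> rfl

@[simp] theorem vars_cast {d d' : C} (h : d = d') (t : Tm S ι c d) :
    (t.cast h).vars = t.vars := by subst h; simp

theorem subst_cast {d d' : C} (h : d = d') (t : Tm S ι c d) (s : ∀ i, Tm S κ k (c i)) :
    (t.cast h).subst s = (t.subst s).cast h := by subst h; simp

theorem subst_subst {d : C} (t : Tm S ι c d) (s : ∀ i, Tm S κ k (c i))
    (u : ∀ i, Tm S μ l (k i)) : (t.subst s).subst u = t.subst (fun i => (s i).subst u) := by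
  induction t with
  | var i h => simp [subst, subst_cast]
  | op g args h ih => simp [subst, ih]

theorem subst_var {d : C} (t : Tm S ι c d) : t.subst (fun i => var i rfl) = t := by
  induction t with
  | var i h => simp [subst, cast]
  | op g args h ih => simp [subst, ih]

theorem vars_subst {d : C} (t : Tm S ι c d) (s : ∀ i, Tm S κ k (c i)) :
    (t.subst s).vars = t.vars.bind (fun i => (s i).vars) := by
  induction t with
  | var i h => simp [subst, vars]
  | op g args h ih =>
    simp only [subst, vars, ih]
    exact (map_sum (M := Multiset ι) (N := Multiset κ)
      (AddMonoidHom.mk ⟨fun m : Multiset ι => m.bind fun i => (s i).vars, Multiset.zero_bind _⟩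
      fun a b => Multiset.add_bind a b _) _ _).symm

theorem Linear.subst {d : C} {t : Tm S ι c d} (ht : t.Linear) {s : ∀ i, Tm S κ k (c i)}
    (h1 : ∀ i, (s i).vars.Nodup) (h2 : ∀ i i' j, j ∈ (s i).vars → j ∈ (s i').vars → i = i')
    (h3 : ∀ j, ∃ i, j ∈ (s i).vars) : (t.subst s).Linear := by
  refine ⟨?_, fun j => ?_⟩
  · rw [vars_subst, Multiset.nodup_bind]
    refine ⟨fun i _ => h1 i, ?_⟩
    exact Multiset.Nodup.pairwise (fun i _ i' _ hne =>
      Multiset.disjoint_left.2 fun hj hj' => hne (h2 i i' _ hj hj')) ht.1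
  · rw [vars_subst, Multiset.mem_bind]
    obtain ⟨i, hi⟩ := h3 j
    exact ⟨i, ht.2 i, hi⟩

/-- Renaming of the variables along a bijection. -/
def ren {d : C} (e : ι ≃ κ) (t : Tm S ι (fun i => k (e i)) d) : Tm S κ k d :=
  t.subst fun i => var (e i) rfl

/-- Substitution of terms in separate variables: the composition of the free operad. -/
def graft {κ : ι → Type} {k : ∀ i, κ i → C} {d : C} (t : Tm S ι c d)
    (x : ∀ i, Tm S (κ i) (k i) (c i)) : Tm S (Σ i, κ i) (fun y => k y.1 y.2) d :=
  t.subst fun i => (x i).subst fun j => var ⟨i, j⟩ rfl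

theorem linear_var {d : C} : (var (S := S) (c := fun _ : Unit => d) () rfl).Linear :=
  ⟨by simp [vars], fun i => by simp [vars]⟩

theorem Linear.ren {d : C} (e : ι ≃ κ) {t : Tm S ι (fun i => k (e i)) d} (ht : t.Linear) :
    (t.ren e).Linear :=
  ht.subst (fun i => by simp [vars]) (fun i i' j h h' => by simp_all [vars])
    fun j => ⟨e.symm j, by simp [vars]⟩

theorem vars_subst_mk {κ : ι → Type} {k : ∀ i, κ i → C} {d : C} (i : ι) (t : Tm S (κ i) (k i) d) :
    (t.subst fun j => var (S := S) (c := fun y : (Σ i, κ i) => k y.1 y.2) ⟨i, j⟩ rfl).vars =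
      t.vars.map (Sigma.mk i) := by
  rw [vars_subst]
  exact Multiset.bind_singleton _ _

theorem Linear.graft {κ : ι → Type} {k : ∀ i, κ i → C} {d : C} {t : Tm S ι c d} (ht : t.Linear)
    {x : ∀ i, Tm S (κ i) (k i) (c i)} (hx : ∀ i, (x i).Linear) : (t.graft x).Linear := by
  refine ht.subst (fun i => ?_) (fun i i' j h h' => ?_) (fun j => ⟨j.1, ?_⟩)
  · rw [vars_subst_mk]
    exact (hx i).1.map sigma_mk_injective
  · rw [vars_subst_mk, Multiset.mem_map] at h h'
    obtain ⟨_, _, rfl⟩ := h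
    obtain ⟨_, _, h⟩ := h'
    exact (congrArg Sigma.fst h).symm
  · rw [vars_subst_mk, Multiset.mem_map]
    exact ⟨j.2, (hx j.1).2 j.2, rfl⟩

theorem graft_graft {κ : ι → Type} {μ : ∀ i, κ i → Type} {k : ∀ i, κ i → C}
    {l : ∀ i j, μ i j → C} {d : C} (t : Tm S ι c d) (x : ∀ i, Tm S (κ i) (k i) (c i))
    (y : ∀ i j, Tm S (μ i j) (l i j) (k i j)) :
    ren (k := fun z : (Σ i, Σ j, μ i j) => l z.1 z.2.1 z.2.2) (Equiv.sigmaAssoc μ)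
      ((t.graft x).graft fun ij => y ij.1 ij.2) = t.graft fun i => (x i).graft (y i) := by
  refine (subst_subst _ _ _).trans ((subst_subst _ _ _).trans (congrArg t.subst (funext fun i => ?_)))
  refine (subst_subst _ _ _).trans (Eq.trans ?_ (subst_subst _ _ _).symm)
  refine congrArg (x i).subst (funext fun j => ?_)
  refine (cast_rfl _).trans ((subst_subst _ _ _).trans (Eq.trans ?_ (subst_subst _ _ _).symm))
  rfl

end Tm

/-- Families of equations between terms of the same colour in the same variables. Below they are
always given as schemes in arbitrary terms `x`, `y`, …, each of which occurs exactly once on either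
side. -/
abbrev Relations {C : Type} (S : Sig C) : Type 1 :=
  ∀ (κ : Type) (k : κ → C) (d : C), Tm S κ k d → Tm S κ k d → Prop

/-- The smallest congruence that contains the relations. As each letter of a relation occurs exactly
once on either side, congruent terms have the same variables with the same multiplicities, and on
linear terms this is the operadic congruence generated by the relations. -/
inductive Cong {C : Type} {S : Sig C} (R : Relations S) {ι : Type} {c : ι → C} :
    ∀ {d : C}, Tm S ι c d → Tm S ι c d → Prop
  | rel {κ : Type} {k : κ → C} {d : C} {s t : Tm S κ k d} (h : R κ k d s t)
      (u : ∀ i, Tm S ι c (k i)) : Cong R (s.subst u) (t.subst u)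
  | op {d : C} (g : S.Op) (x y : ∀ j, Tm S ι c (S.inp g j)) (h : S.out g = d)
      (hxy : ∀ j, Cong R (x j) (y j)) : Cong R (.op g x h) (.op g y h)
  | refl {d : C} (t : Tm S ι c d) : Cong R t t
  | symm {d : C} {s t : Tm S ι c d} : Cong R s t → Cong R t s
  | trans {d : C} {s t u : Tm S ι c d} : Cong R s t → Cong R t u → Cong R s u

namespace Cong

variable {C : Type} {S : Sig C} {R : Relations S} {ι κ : Type} {c : ι → C} {k : κ → C}

theorem cast {d d' : C} (h : d = d') {s t : Tm S ι c d} (hst : Cong R s t) :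
    Cong R (s.cast h) (t.cast h) := by subst h; simpa using hst

theorem subst_right {d : C} (t : Tm S ι c d) {u v : ∀ i, Tm S κ k (c i)}
    (h : ∀ i, Cong R (u i) (v i)) : Cong R (t.subst u) (t.subst v) := by
  induction t with
  | var i h' => exact (h i).cast h'
  | op g args h' ih => exact .op g _ _ h' ih

theorem subst_left {d : C} {s t : Tm S ι c d} (h : Cong R s t) (u : ∀ i, Tm S κ k (c i)) :
    Cong R (s.subst u) (t.subst u) := by
  induction h with
  | rel h v => simpa only [Tm.subst_subst] using Cong.rel h _
  | op g x y h' _ ih => exact .op g _ _ h' ih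
  | refl t => exact .refl _
  | symm _ ih => exact ih.symm
  | trans _ _ ih ih' => exact ih.trans ih'

theorem subst {d : C} {s t : Tm S ι c d} (h : Cong R s t) {u v : ∀ i, Tm S κ k (c i)}
    (huv : ∀ i, Cong R (u i) (v i)) : Cong R (s.subst u) (t.subst v) :=
  (h.subst_left u).trans (subst_right t huv)

theorem graft {κ : ι → Type} {k : ∀ i, κ i → C} {d : C} {s t : Tm S ι c d} (h : Cong R s t)
    {x y : ∀ i, Tm S (κ i) (k i) (c i)} (hxy : ∀ i, Cong R (x i) (y i)) :
    Cong R (s.graft x) (t.graft y) :=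
  h.subst fun i => (hxy i).subst_left _

end Cong

namespace Presented

variable {C : Type} {S : Sig C} (R : Relations S)

/-- Congruence of linear terms. -/
def setoid (ι : Type) (c : ι → C) (d : C) : Setoid {t : Tm S ι c d // t.Linear} where
  r s t := Cong R s.1 t.1
  iseqv := ⟨fun t => .refl t.1, .symm, .trans⟩

/-- Operations of the operad generated by `S` with relations `R`. -/
def Hom (ι : Type) (c : ι → C) (d : C) : Type := Quotient (setoid R ι c d)

variable {R} {ι κ : Type} {c : ι → C} {k : κ → C}

/-- The class of a linear term. -/
def mk {d : C} (t : Tm S ι c d) (h : t.Linear) : Hom R ι c d := Quotient.mk (setoid R ι c d) ⟨t, h⟩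

theorem mk_eq {d : C} {s t : Tm S ι c d} {hs : s.Linear} {ht : t.Linear} (h : Cong R s t) :
    (mk s hs : Hom R ι c d) = mk t ht := Quotient.sound h

theorem exists_rep {d : C} (f : Hom R ι c d) : ∃ t h, f = mk t h := by
  obtain ⟨⟨t, h⟩, rfl⟩ := Quotient.exists_rep f
  exact ⟨t, h, rfl⟩

theorem exists_rep_fun {κ : ι → Type} {k : ∀ i, κ i → C} (x : ∀ i, Hom R (κ i) (k i) (c i)) :
    ∃ (t : ∀ i, Tm S (κ i) (k i) (c i)) (h : ∀ i, (t i).Linear), x = fun i => mk (t i) (h i) := by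
  choose t h e using fun i => exists_rep (x i)
  exact ⟨t, h, funext e⟩

/-- Action of bijections. -/
def map {d : C} (e : ι ≃ κ) : Hom R ι (fun i => k (e i)) d → Hom R κ k d :=
  Quotient.map' (fun t => ⟨t.1.ren e, t.2.ren e⟩) fun _ _ h => Cong.subst_left h _

/-- Composition. -/
noncomputable def comp {κ : ι → Type} {k : ∀ i, κ i → C} {d : C} (f : Hom R ι c d)
    (x : ∀ i, Hom R (κ i) (k i) (c i)) : Hom R (Σ i, κ i) (fun y => k y.1 y.2) d :=
  mk (f.out.1.graft fun i => (x i).out.1) (f.out.2.graft fun i => (x i).out.2)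

theorem comp_mk {κ : ι → Type} {k : ∀ i, κ i → C} {d : C} (t : Tm S ι c d) (h : t.Linear)
    (x : ∀ i, Tm S (κ i) (k i) (c i)) (hx : ∀ i, (x i).Linear) :
    comp (mk t h : Hom R ι c d) (fun i => mk (x i) (hx i)) = mk (t.graft x) (h.graft hx) :=
  mk_eq (Cong.graft (Quotient.mk_out (s := setoid R ι c d) ⟨t, h⟩)
    fun i => Quotient.mk_out (s := setoid R (κ i) (k i) (c i)) ⟨x i, hx i⟩)

theorem mk_congr {d : C} {s t : Tm S ι c d} {hs : s.Linear} {ht : t.Linear} (h : s = t) :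
    (mk s hs : Hom R ι c d) = mk t ht := by subst h; rfl

end Presented

/-- The coloured symmetric operad generated by `S` subject to the relations `R`. -/
noncomputable def presented {C : Type} {S : Sig C} (R : Relations S) : ColOperad C where
  Hom ι _ c d := Presented.Hom R ι c d
  one d := Presented.mk (.var () rfl) Tm.linear_var
  map e _ _ f := Presented.map e f
  comp f x := Presented.comp f x
  map_refl f := by
    obtain ⟨t, h, rfl⟩ := Presented.exists_rep f
    exact Presented.mk_congr t.subst_var
  map_trans e e' c d f := by
    obtain ⟨t, h, rfl⟩ := Presented.exists_rep f
    refine Presented.mk_congr ?_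
    change _ = Tm.subst (Tm.subst _ _) _
    rw [Tm.subst_subst]
    rfl
  map_comp_left e κ _ c k d f x := by
    obtain ⟨t, h, rfl⟩ := Presented.exists_rep f
    obtain ⟨x, hx, rfl⟩ := Presented.exists_rep_fun x
    refine (Presented.comp_mk (t.ren e) (h.ren e) x hx).trans ((Presented.mk_congr ?_).trans
      (congrArg (Presented.map (k := fun y : (Σ i, κ i) => k y.1 y.2) (Equiv.sigmaCongrLeft e))
        (Presented.comp_mk t h (fun i => x (e i)) (fun i => hx (e i))).symm))
    simp only [Tm.ren, Tm.graft, Tm.subst_subst, Tm.subst, Tm.cast_rfl]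
    refine Eq.symm ((Tm.subst_subst _ _ _).trans (congrArg t.subst (funext fun i => ?_)))
    exact Tm.subst_subst _ _ _
  map_comp_right {ι} _ κ κ' _ _ e c k d f x := by
    obtain ⟨t, h, rfl⟩ := Presented.exists_rep f
    obtain ⟨x, hx, rfl⟩ := Presented.exists_rep_fun x
    refine (Presented.comp_mk t h (fun i => (x i).ren (e i)) (fun i => (hx i).ren (e i))).trans
      ((Presented.mk_congr ?_).trans (congrArg (Presented.map
        (k := fun y : (Σ i, κ' i) => k y.1 y.2) (Equiv.sigmaCongrRight e))
        (Presented.comp_mk t h x hx).symm))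
    simp only [Tm.ren, Tm.graft, Tm.subst_subst, Tm.subst, Tm.cast_rfl]
    refine Eq.symm ((Tm.subst_subst _ _ _).trans (congrArg t.subst (funext fun i => ?_)))
    exact Tm.subst_subst _ _ _
  one_comp {κ} _ k d x := by
    obtain ⟨x, hx, rfl⟩ := Presented.exists_rep x
    refine (Presented.comp_mk _ _ (fun _ => x) (fun _ => hx)).trans (Presented.mk_congr ?_)
    simp only [Tm.ren, Tm.graft, Tm.subst, Tm.cast_rfl]
    rfl
  comp_one f := by
    obtain ⟨t, h, rfl⟩ := Presented.exists_rep f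
    refine (Presented.comp_mk _ _ (fun _ => .var () rfl) (fun _ => Tm.linear_var)).trans
      (Presented.mk_congr ?_)
    simp only [Tm.ren, Tm.graft, Tm.subst, Tm.cast_rfl]
    rfl
  assoc f x y := by
    obtain ⟨t, h, rfl⟩ := Presented.exists_rep f
    obtain ⟨x, hx, rfl⟩ := Presented.exists_rep_fun x
    choose y' hy' e using fun i j => Presented.exists_rep (y i j)
    obtain rfl : y = fun i j => Presented.mk (y' i j) (hy' i j) := by
      funext i j; exact e i j
    simp only [Presented.comp_mk]
    refine Presented.mk_congr ?_
    exact Tm.graft_graft t x y'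

/-- An assignment, to every generator of `S`, of an operation of the free operad on `S'` with the
corresponding colours. -/
structure Transl {C D : Type} (S : Sig C) (S' : Sig D) (f : C → D) where
  tm : ∀ g : S.Op, Tm S' (S.Ar g) (fun j => f (S.inp g j)) (f (S.out g))
  linear : ∀ g, (tm g).Linear

namespace Tm

variable {C D : Type} {S : Sig C} {S' : Sig D} {f : C → D} (φ : Transl S S' f)
  {ι κ : Type} {c : ι → C} {k : κ → C}

/-- The extension of an assignment on generators to all terms. -/
def tr {d : C} : Tm S ι c d → Tm S' ι (fun i => f (c i)) (f d)
  | var i h => var i (congrArg f h)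
  | op g args h => ((φ.tm g).subst fun j => (args j).tr).cast (congrArg f h)

theorem tr_cast {d d' : C} (h : d = d') (t : Tm S ι c d) :
    (t.cast h).tr φ = (t.tr φ).cast (congrArg f h) := by subst h; simp

theorem tr_subst {d : C} (t : Tm S ι c d) (s : ∀ i, Tm S κ k (c i)) :
    (t.subst s).tr φ = (t.tr φ).subst fun i => (s i).tr φ := by
  induction t with
  | var i h => exact tr_cast φ h (s i)
  | op g args h ih => simp only [subst, tr, subst_cast, subst_subst, ih]

theorem vars_tr {d : C} (t : Tm S ι c d) : (t.tr φ).vars = t.vars := by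
  induction t with
  | var i h => rfl
  | op g args h ih =>
    simp only [tr, vars_cast, vars_subst, ih, vars]
    have e : (φ.tm g).vars = Finset.univ.val :=
      ((φ.linear g).1.ext Finset.univ.nodup).2 fun j => by simp [(φ.linear g).2 j]
    rw [e]
    rfl

theorem Linear.tr {d : C} {t : Tm S ι c d} (h : t.Linear) : (t.tr φ).Linear := by
  unfold Linear
  rw [vars_tr]
  exact h

end Tm

theorem Cong.tr {C D : Type} {S : Sig C} {S' : Sig D} {f : C → D} (φ : Transl S S' f)
    {R : Relations S} {R' : Relations S'}
    (hφ : ∀ κ k d s t, R κ k d s t → Cong R' (s.tr φ) (t.tr φ))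
    {ι : Type} {c : ι → C} {d : C} {s t : Tm S ι c d} (h : Cong R s t) :
    Cong R' (s.tr φ) (t.tr φ) := by
  induction h with
  | rel h u =>
    simp only [Tm.tr_subst]
    exact (hφ _ _ _ _ _ h).subst_left _
  | op g x y h _ ih => exact (Cong.subst_right _ ih).cast _
  | refl t => exact .refl _
  | symm _ ih => exact ih.symm
  | trans _ _ ih ih' => exact ih.trans ih'

/-- The morphism of presented operads determined by an assignment on generators that respects the
relations. -/
noncomputable def Transl.morphism {C D : Type} {S : Sig C} {S' : Sig D} {f : C → D}
    (φ : Transl S S' f) (R : Relations S) (R' : Relations S')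
    (hφ : ∀ κ k d s t, R κ k d s t → Cong R' (s.tr φ) (t.tr φ)) :
    ColOperad.Morphism (presented R) (presented R') where
  colour := f
  app := Quotient.map' (fun t => ⟨t.1.tr φ, t.2.tr φ⟩) fun _ _ h => Cong.tr φ hφ h
  app_one d := rfl
  app_map e c d x := by
    obtain ⟨t, h, rfl⟩ := Presented.exists_rep x
    exact Presented.mk_congr (Tm.tr_subst φ _ _)
  app_comp x y := by
    obtain ⟨t, h, rfl⟩ := Presented.exists_rep x
    obtain ⟨y, hy, rfl⟩ := Presented.exists_rep_fun y
    refine (congrArg (Quotient.map' _ _) (Presented.comp_mk t h y hy)).trans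
      ((Presented.mk_congr ?_).trans
        (Presented.comp_mk (t.tr φ) (h.tr φ) (fun i => (y i).tr φ) fun i => (hy i).tr φ).symm)
    refine (Tm.tr_subst φ _ _).trans (congrArg (t.tr φ).subst (funext fun i => ?_))
    exact Tm.tr_subst φ _ _

namespace Blk

variable {n : ℕ} (m : Fin n → ℕ)

/-- For consecutive blocks of sizes `m 0, m 1, …`, the number of elements before the `k`-th block. -/
def off (k : ℕ) : ℕ := ∑ i : Fin n, if i.val < k then m i else 0

theorem off_le (k : ℕ) : off m k ≤ ∑ i, m i :=
  Finset.sum_le_sum fun i _ => by split <;> omega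

theorem off_zero : off m 0 = 0 := by simp [off]

theorem off_last : off m n = ∑ i, m i := Finset.sum_congr rfl fun i _ => by simp

theorem off_succ (i : Fin n) : off m (i.val + 1) = off m i.val + m i := by
  have h : m i = ∑ j : Fin n, if j = i then m j else 0 := by simp
  unfold off
  rw [h, ← Finset.sum_add_distrib]
  refine Finset.sum_congr rfl fun j _ => ?_
  by_cases hj : j = i
  · subst hj; simp
  · have : j.val ≠ i.val := fun h => hj (Fin.ext h)
    simp only [hj, if_false, add_zero]
    congr 1
    exact propext (by omega)

theorem off_add_le (i : Fin n) : off m i.val + m i ≤ ∑ i, m i :=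
  (off_succ m i).symm.trans_le (off_le m _)

/-- Position of the `j`-th element of the `i`-th block in the concatenation of all blocks. -/
def idx (i : Fin n) (j : Fin (m i)) : Fin (∑ i, m i) :=
  ⟨off m i.val + j.val, by have := off_add_le m i; omega⟩

/-- Position of the `j`-th boundary (`0 ≤ j ≤ m i`) of the `i`-th block among all boundaries. -/
def bdry (i : Fin n) (j : Fin (m i + 1)) : Fin (∑ i, m i + 1) :=
  ⟨off m i.val + j.val, by have := off_add_le m i; omega⟩

/-- Position of the boundary at which the `i`-th block starts; for `i = n`, the last boundary. -/
def start (i : Fin (n + 1)) : Fin (∑ i, m i + 1) :=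
  ⟨off m i.val, by have := off_le m i.val; omega⟩

theorem start_zero : start m 0 = 0 := Fin.ext (off_zero m)

theorem start_last : start m (Fin.last n) = Fin.last _ := Fin.ext (off_last m)

theorem bdry_zero (i : Fin n) : bdry m i 0 = start m i.castSucc := Fin.ext (by simp [bdry, start])

theorem bdry_last (i : Fin n) : bdry m i (Fin.last (m i)) = start m i.succ :=
  Fin.ext (by simp [bdry, start, off_succ])

theorem sum_idx (q : Fin (∑ i, m i) → ℕ) : ∑ i, ∑ j, q (idx m i j) = ∑ k, q k := by
  rw [← Equiv.sum_comp finSigmaFinEquiv q, Fintype.sum_sigma]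
  refine Finset.sum_congr rfl fun i _ => Finset.sum_congr rfl fun j _ => congrArg q (Fin.ext ?_)
  rw [finSigmaFinEquiv_apply]
  simp only [idx, off]
  congr 1
  rw [← Finset.sum_filter]
  refine Finset.sum_bij' (fun a ha => ⟨a.val, by simpa using ha⟩) (fun a _ => Fin.castLE i.isLt.le a)
    ?_ (fun a _ => Finset.mem_filter.2 ⟨Finset.mem_univ _, a.isLt⟩) ?_ ?_ ?_ <;> simp

end Blk

/-- Generators of `Op`: `C_{q₁,…,qₙ} ∈ Op(n, q₁, …, qₙ; q₁ + ⋯ + qₙ)` and `η ∈ Op(; 1)`. -/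
inductive OpGen : Type
  | C (n : ℕ) (q : Fin n → ℕ) : OpGen
  | unit : OpGen

/-- Inputs and output of the generators of `Op`: the input `none` is the first one, of colour `n`,
and `some i` is the one of colour `q i`. -/
def opSig : Sig ℕ where
  Op := OpGen
  Ar
    | .C n _ => Option (Fin n)
    | .unit => Empty
  fin
    | .C n _ => inferInstanceAs (Fintype (Option (Fin n)))
    | .unit => inferInstanceAs (Fintype Empty)
  inp
    | .C n _, none => n
    | .C _ q, some i => q i
  out
    | .C _ q => ∑ i, q i
    | .unit => 1

namespace OpTerm

variable {ι : Type} {c : ι → ℕ}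

/-- The term `C_q(x; y₁, …, yₙ)`. -/
def C {d : ℕ} (n : ℕ) (q : Fin n → ℕ) (x : Tm opSig ι c n) (y : ∀ i, Tm opSig ι c (q i))
    (h : ∑ i, q i = d) : Tm opSig ι c d :=
  .op (.C n q) (fun
    | none => x
    | some i => y i) h

/-- The unit `η`. -/
def unit : Tm opSig ι c 1 := .op .unit (fun j => j.elim) rfl

end OpTerm

/-- Relations of `Op`: `C(C(x; y₁, …, yₙ); z¹₁, …) = C(x; C(y₁; z¹₁, …), …, C(yₙ; zⁿ₁, …))` and
`C₁(η; x) = x = C(x; η, …, η)`. -/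
inductive OpRel : ∀ (κ : Type) (k : κ → ℕ) (d : ℕ), Tm opSig κ k d → Tm opSig κ k d → Prop
  | assoc {κ : Type} {k : κ → ℕ} (n : ℕ) (m : Fin n → ℕ) (q : Fin (∑ i, m i) → ℕ)
      (x : Tm opSig κ k n) (y : ∀ i, Tm opSig κ k (m i)) (z : ∀ j, Tm opSig κ k (q j)) :
    OpRel κ k (∑ j, q j)
      (OpTerm.C (∑ i, m i) q (OpTerm.C n m x y rfl) z rfl)
      (OpTerm.C n (fun i => ∑ j, q (Blk.idx m i j)) x
        (fun i => OpTerm.C (m i) (fun j => q (Blk.idx m i j)) (y i)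
          (fun j => z (Blk.idx m i j)) rfl)
        (Blk.sum_idx m q))
  | unit_left {κ : Type} {k : κ → ℕ} (n : ℕ) (x : Tm opSig κ k n) :
    OpRel κ k n (OpTerm.C 1 (fun _ => n) OpTerm.unit (fun _ => x) (by simp)) x
  | unit_right {κ : Type} {k : κ → ℕ} (n : ℕ) (x : Tm opSig κ k n) :
    OpRel κ k n (OpTerm.C n (fun _ => 1) x (fun _ => OpTerm.unit) (by simp)) x

/-- The `ℕ`-coloured symmetric operad `Op`. -/
noncomputable def OpOperad : ColOperad ℕ := presented OpRel

/-- Generators of `Pro`: `M_{p,r,t}`, `P_{p,r}^{p',r'}`, `η_P` and `η_M`. -/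
inductive ProGen : Type
  | M (p r t : ℕ) : ProGen
  | P (p r p' r' : ℕ) : ProGen
  | etaP : ProGen
  | etaM : ProGen

/-- Inputs and outputs of the generators of `Pro`, with colours `(p, r)`. -/
def proSig : Sig (ℕ × ℕ) where
  Op := ProGen
  Ar
    | .M _ _ _ => Fin 2
    | .P _ _ _ _ => Fin 2
    | .etaP => Empty
    | .etaM => Empty
  fin
    | .M _ _ _ => inferInstanceAs (Fintype (Fin 2))
    | .P _ _ _ _ => inferInstanceAs (Fintype (Fin 2))
    | .etaP => inferInstanceAs (Fintype Empty)
    | .etaM => inferInstanceAs (Fintype Empty)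
  inp
    | .M p r t => ![(p, r), (r, t)]
    | .P p r p' r' => ![(p, r), (p', r')]
    | .etaP => fun j => j.elim
    | .etaM => fun j => j.elim
  out
    | .M p _ t => (p, t)
    | .P p r p' r' => (p + p', r + r')
    | .etaP => (0, 0)
    | .etaM => (1, 1)

namespace ProTerm

variable {ι : Type} {c : ι → ℕ × ℕ}

/-- `M_{p,r,t}(x, y)`, horizontal composition. -/
def M {p r t : ℕ} (x : Tm proSig ι c (p, r)) (y : Tm proSig ι c (r, t)) :
    Tm proSig ι c (p, t) :=
  .op (.M p r t) (fun
    | (0 : Fin 2) => x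
    | (1 : Fin 2) => y) rfl

/-- `P_{p,r}^{p',r'}(x, y)`, juxtaposition with `x` on top. -/
def P {p r p' r' : ℕ} {d : ℕ × ℕ} (x : Tm proSig ι c (p, r)) (y : Tm proSig ι c (p', r'))
    (h : (p + p', r + r') = d) : Tm proSig ι c d :=
  .op (.P p r p' r') (fun
    | (0 : Fin 2) => x
    | (1 : Fin 2) => y) h

/-- `η_P ∈ Pro(; (0,0))`. -/
def etaP : Tm proSig ι c (0, 0) := .op .etaP (fun j => j.elim) rfl

/-- `η_M ∈ Pro(; (1,1))`. -/
def etaM : Tm proSig ι c (1, 1) := .op .etaM (fun j => j.elim) rfl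

/-- `η_M^r ∈ Pro(; (r,r))`, the `r`-fold juxtaposition of `η_M`, which is `η_P` for `r = 0`. -/
def ident : ∀ r : ℕ, Tm proSig ι c (r, r)
  | 0 => etaP
  | r + 1 => P (ident r) etaM rfl

/-- The iterated composition `M(… M(M(y₁, y₂), y₃) …, yₙ)`. The recursion starts with the identity
`η_M^{p₀}`, which is neutral for `M`; so it is `y₁` for `n = 1` and `η_M^{p₀}` for `n = 0`. -/
def iterM : ∀ (n : ℕ) (p : Fin (n + 1) → ℕ)
    (_ : ∀ i : Fin n, Tm proSig ι c (p i.castSucc, p i.succ)), Tm proSig ι c (p 0, p (Fin.last n))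
  | 0, p, _ => ident (p 0)
  | n + 1, p, y => M (iterM n (fun i => p i.castSucc) fun i => y i.castSucc) (y (Fin.last n))

end ProTerm

open ProTerm in
/-- Relations of `Pro`: associativity of `M` and of `P`, the interchange law, and the unit laws for
`η_P` and for `η_M^r`. -/
inductive ProRel : ∀ (κ : Type) (k : κ → ℕ × ℕ) (d : ℕ × ℕ),
    Tm proSig κ k d → Tm proSig κ k d → Prop
  | assoc_M {κ : Type} {k : κ → ℕ × ℕ} {p r t s : ℕ} (x : Tm proSig κ k (p, r))
      (y : Tm proSig κ k (r, t)) (z : Tm proSig κ k (t, s)) :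
    ProRel κ k (p, s) (M (M x y) z) (M x (M y z))
  | assoc_P {κ : Type} {k : κ → ℕ × ℕ} {p r p' r' p'' r'' : ℕ} (x : Tm proSig κ k (p, r))
      (y : Tm proSig κ k (p', r')) (z : Tm proSig κ k (p'', r'')) :
    ProRel κ k (p + p' + p'', r + r' + r'') (P (P x y rfl) z rfl)
      (P x (P y z rfl) (by simp only [add_assoc]))
  | interchange {κ : Type} {k : κ → ℕ × ℕ} {p r t p' r' t' : ℕ} (x : Tm proSig κ k (p, r))
      (x' : Tm proSig κ k (p', r')) (y : Tm proSig κ k (r, t)) (y' : Tm proSig κ k (r', t')) :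
    ProRel κ k (p + p', t + t') (M (P x x' rfl) (P y y' rfl)) (P (M x y) (M x' y') rfl)
  | unit_P_right {κ : Type} {k : κ → ℕ × ℕ} {p r : ℕ} (x : Tm proSig κ k (p, r)) :
    ProRel κ k (p, r) (P x etaP rfl) x
  | unit_P_left {κ : Type} {k : κ → ℕ × ℕ} {p r : ℕ} (x : Tm proSig κ k (p, r)) :
    ProRel κ k (p, r) (P etaP x (by simp only [zero_add])) x
  | unit_M_right {κ : Type} {k : κ → ℕ × ℕ} {p r : ℕ} (x : Tm proSig κ k (p, r)) :
    ProRel κ k (p, r) (M x (ident r)) x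
  | unit_M_left {κ : Type} {k : κ → ℕ × ℕ} {p r : ℕ} (x : Tm proSig κ k (p, r)) :
    ProRel κ k (p, r) (M (ident p) x) x

/-- The `ℕ × ℕ`-coloured symmetric operad `Pro`, whose algebras are pros. -/
noncomputable def ProOperad : ColOperad (ℕ × ℕ) := presented ProRel

/-- Generators of the box operad: `C^{p₀,…,pₙ;a,b}_{q₁,…,qₙ}` for `n ≥ 0`, and `η`. -/
inductive BoxGen : Type
  | C (n : ℕ) (q : Fin n → ℕ) (p : Fin (n + 1) → ℕ) (a b : ℕ) : BoxGen
  | unit : BoxGen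

/-- Colours are triples `(p, q, r)`. The generator `C^{p₀,…,pₙ;a,b}_{q₁,…,qₙ}` has an input `none` of
colour `(a, n, b)`, inputs `some i` of colours `(p_{i-1}, q_i, p_i)`, and output colour
`(a + p₀, q₁ + ⋯ + qₙ, b + pₙ)`; the unit has no input and output colour `(0, 1, 0)`. -/
def boxSig : Sig (ℕ × ℕ × ℕ) where
  Op := BoxGen
  Ar
    | .C n _ _ _ _ => Option (Fin n)
    | .unit => Empty
  fin
    | .C n _ _ _ _ => inferInstanceAs (Fintype (Option (Fin n)))
    | .unit => inferInstanceAs (Fintype Empty)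
  inp
    | .C n _ _ a b, none => (a, n, b)
    | .C _ q p _ _, some i => (p i.castSucc, q i, p i.succ)
  out
    | .C n q p a b => (a + p 0, ∑ i, q i, b + p (Fin.last n))
    | .unit => (0, 1, 0)

namespace BoxTerm

variable {ι : Type} {c : ι → ℕ × ℕ × ℕ}

/-- The term `C^{p₀,…,pₙ;a,b}_{q₁,…,qₙ}(x; y₁, …, yₙ)`. -/
def C {d : ℕ × ℕ × ℕ} (n : ℕ) (q : Fin n → ℕ) (p : Fin (n + 1) → ℕ) (a b : ℕ)
    (x : Tm boxSig ι c (a, n, b)) (y : ∀ i : Fin n, Tm boxSig ι c (p i.castSucc, q i, p i.succ))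
    (h : (a + p 0, ∑ i, q i, b + p (Fin.last n)) = d) : Tm boxSig ι c d :=
  .op (.C n q p a b) (fun
    | none => x
    | some i => y i) h

/-- The unit `η`. -/
def unit : Tm boxSig ι c (0, 1, 0) := .op .unit (fun j => j.elim) rfl

end BoxTerm

/-- Relations of the box operad: associativity and units. The boundary colours of all `zⁱⱼ` form one
sequence `s`, the concatenation of the sequences of the blocks, of which consecutive ones share an
endpoint. The `i`-th boundary colour of the outer generator on the right-hand side is `pᵢ` plus the
boundary colour at the start of block `i + 1` (the end of block `i`). -/
inductive BoxRel : ∀ (κ : Type) (k : κ → ℕ × ℕ × ℕ) (d : ℕ × ℕ × ℕ),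
    Tm boxSig κ k d → Tm boxSig κ k d → Prop
  | assoc {κ : Type} {k : κ → ℕ × ℕ × ℕ} (n : ℕ) (m : Fin n → ℕ) (p : Fin (n + 1) → ℕ)
      (a b : ℕ) (q : Fin (∑ i, m i) → ℕ) (s : Fin (∑ i, m i + 1) → ℕ)
      (x : Tm boxSig κ k (a, n, b))
      (y : ∀ i : Fin n, Tm boxSig κ k (p i.castSucc, m i, p i.succ))
      (z : ∀ j, Tm boxSig κ k (s j.castSucc, q j, s j.succ)) :
    BoxRel κ k (a + p 0 + s 0, ∑ j, q j, b + p (Fin.last n) + s (Fin.last _))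
      (BoxTerm.C (∑ i, m i) q s (a + p 0) (b + p (Fin.last n)) (BoxTerm.C n m p a b x y rfl) z rfl)
      (BoxTerm.C n (fun i => ∑ j, q (Blk.idx m i j)) (fun i => p i + s (Blk.start m i)) a b x
        (fun i => BoxTerm.C (m i) (fun j => q (Blk.idx m i j)) (fun j => s (Blk.bdry m i j))
          (p i.castSucc) (p i.succ) (y i) (fun j => z (Blk.idx m i j))
          (by rw [Blk.bdry_zero, Blk.bdry_last]))
        (by rw [Blk.start_zero, Blk.start_last, Blk.sum_idx, add_assoc, add_assoc]))
  | unit_left {κ : Type} {k : κ → ℕ × ℕ × ℕ} (p n r : ℕ) (x : Tm boxSig κ k (p, n, r)) :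
    BoxRel κ k (p, n, r)
      (BoxTerm.C 1 (fun _ => n) ![p, r] 0 0 BoxTerm.unit (fun | 0 => x) (by simp)) x
  | unit_right {κ : Type} {k : κ → ℕ × ℕ × ℕ} (p n r : ℕ) (x : Tm boxSig κ k (p, n, r)) :
    BoxRel κ k (p, n, r)
      (BoxTerm.C n (fun _ => 1) (fun _ => 0) p r x (fun _ => BoxTerm.unit) (by simp)) x

/-- The `ℕ³`-coloured symmetric operad `□p`. -/
noncomputable def BoxOperad : ColOperad (ℕ × ℕ × ℕ) := presented BoxRel


namespace OpTerm

variable {ι κ : Type} {c : ι → ℕ} {k : κ → ℕ}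

theorem linear_C (n : ℕ) (q : Fin n → ℕ) (k : Option (Fin n) → ℕ) (h₀ : k none = n)
    (h : ∀ i, k (some i) = q i) :
    (C n q (.var none h₀) (fun i => .var (some i) (h i)) rfl : Tm opSig _ k _).Linear := by
  have e : (C n q (.var none h₀) (fun i => .var (some i) (h i)) rfl : Tm opSig _ k _).vars =
      (Finset.univ : Finset (Option (Fin n))).val := by
    change (∑ j : Option (Fin n), _ : Multiset (Option (Fin n))) = _
    rw [← Finset.sum_multiset_singleton]
    exact Finset.sum_congr rfl fun j _ => by cases j <;> rfl
  exact ⟨e ▸ Finset.univ.nodup, fun i => e ▸ Finset.mem_univ i⟩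

theorem C_congr {d : ℕ} (n : ℕ) (q : Fin n → ℕ) {x x' : Tm opSig ι c n}
    {y y' : ∀ i, Tm opSig ι c (q i)} (h : ∑ i, q i = d) (hx : x = x') (hy : ∀ i, y i = y' i) :
    C n q x y h = C n q x' y' h := by
  obtain rfl := hx
  obtain rfl := funext hy
  rfl

theorem subst_C {d : ℕ} (n : ℕ) (q : Fin n → ℕ) (x : Tm opSig ι c n)
    (y : ∀ i, Tm opSig ι c (q i)) (h : ∑ i, q i = d) (u : ∀ i, Tm opSig κ k (c i)) :
    (C n q x y h).subst u = C n q (x.subst u) (fun i => (y i).subst u) h := by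
  refine congrArg (fun a => Tm.op (S := opSig) (OpGen.C n q) a h) (funext fun j => ?_)
  cases j <;> rfl

end OpTerm

namespace ProTerm

variable {ι κ : Type} {c : ι → ℕ × ℕ} {k : κ → ℕ × ℕ}

theorem subst_M {p r t : ℕ} (x : Tm proSig ι c (p, r)) (y : Tm proSig ι c (r, t))
    (u : ∀ i, Tm proSig κ k (c i)) : (M x y).subst u = M (x.subst u) (y.subst u) := by
  refine congrArg (fun a => Tm.op (S := proSig) (ProGen.M p r t) a rfl) (funext fun j => ?_)
  exact match j with
    | (0 : Fin 2) => rfl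
    | (1 : Fin 2) => rfl

theorem subst_P {p r p' r' : ℕ} {d : ℕ × ℕ} (x : Tm proSig ι c (p, r))
    (y : Tm proSig ι c (p', r')) (h : (p + p', r + r') = d) (u : ∀ i, Tm proSig κ k (c i)) :
    (P x y h).subst u = P (x.subst u) (y.subst u) h := by
  refine congrArg (fun a => Tm.op (S := proSig) (ProGen.P p r p' r') a h) (funext fun j => ?_)
  exact match j with
    | (0 : Fin 2) => rfl
    | (1 : Fin 2) => rfl

theorem subst_etaP (u : ∀ i, Tm proSig κ k (c i)) : (etaP : Tm proSig ι c _).subst u = etaP :=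
  congrArg (fun a => Tm.op (S := proSig) .etaP a rfl) (funext fun j => j.elim)

theorem subst_etaM (u : ∀ i, Tm proSig κ k (c i)) : (etaM : Tm proSig ι c _).subst u = etaM :=
  congrArg (fun a => Tm.op (S := proSig) .etaM a rfl) (funext fun j => j.elim)

theorem subst_ident (u : ∀ i, Tm proSig κ k (c i)) (r : ℕ) :
    (ident r : Tm proSig ι c _).subst u = ident r := by
  induction r with
  | zero => exact subst_etaP u
  | succ r ih => rw [ident, ident, subst_P, ih, subst_etaM]

theorem subst_iterM (u : ∀ i, Tm proSig κ k (c i)) (n : ℕ) (p : Fin (n + 1) → ℕ)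
    (y : ∀ i : Fin n, Tm proSig ι c (p i.castSucc, p i.succ)) :
    (iterM n p y).subst u = iterM n p fun i => (y i).subst u := by
  induction n with
  | zero => exact subst_ident u _
  | succ n ih =>
    exact (subst_M _ _ u).trans (congrArg (M · _) (ih _ _))

theorem vars_M {p r t : ℕ} (x : Tm proSig ι c (p, r)) (y : Tm proSig ι c (r, t)) :
    (M x y).vars = x.vars + y.vars := Fin.sum_univ_two _

theorem vars_P {p r p' r' : ℕ} {d : ℕ × ℕ} (x : Tm proSig ι c (p, r))
    (y : Tm proSig ι c (p', r')) (h : (p + p', r + r') = d) :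
    (P x y h).vars = x.vars + y.vars := Fin.sum_univ_two _

theorem vars_ident (r : ℕ) : (ident r : Tm proSig ι c _).vars = 0 := by
  induction r with
  | zero => rfl
  | succ r ih => rw [ident, vars_P, ih]; rfl

theorem vars_iterM (n : ℕ) (p : Fin (n + 1) → ℕ)
    (y : ∀ i : Fin n, Tm proSig ι c (p i.castSucc, p i.succ)) :
    (iterM n p y).vars = ∑ i, (y i).vars := by
  induction n with
  | zero => exact vars_ident _
  | succ n ih =>
    rw [Fin.sum_univ_castSucc]
    exact (vars_M _ _).trans (congrArg (· + _) (ih _ _))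

theorem linear_C (n : ℕ) (p : Fin (n + 1) → ℕ) (a b : ℕ) (k : Option (Fin n) → ℕ × ℕ)
    (h₀ : k none = (a, b)) (h : ∀ i, k (some i) = (p i.castSucc, p i.succ)) :
    (P (.var none h₀) (iterM n p fun i => .var (some i) (h i)) rfl : Tm proSig _ k _).Linear := by
  have e : (P (.var none h₀) (iterM n p fun i => .var (some i) (h i)) rfl :
      Tm proSig _ k _).vars = (Finset.univ : Finset (Option (Fin n))).val := by
    rw [vars_P, vars_iterM, ← Finset.sum_multiset_singleton, Fintype.sum_option]
    rfl
  exact ⟨e ▸ Finset.univ.nodup, fun i => e ▸ Finset.mem_univ i⟩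

end ProTerm

/-- `C^{p₀,…,pₙ;a,b}_{q₁,…,qₙ} ↦ C_{q₁,…,qₙ}` and `η ↦ η`, over `(p, q, r) ↦ q`. -/
def transV : Transl boxSig opSig (fun d => d.2.1) where
  tm
    | .C n q _ _ _ => OpTerm.C n q (.var none rfl) (fun i => .var (some i) rfl) rfl
    | .unit => OpTerm.unit
  linear
    | .C n q _ _ _ => OpTerm.linear_C n q _ rfl fun _ => rfl
    | .unit => ⟨Multiset.nodup_zero, fun i => i.elim⟩

/-- `C^{p₀,…,pₙ;a,b}_{q₁,…,qₙ}(x; y₁, …, yₙ) ↦ P_{a,b}^{p₀,pₙ}(x, M(… M(y₁, y₂) …, yₙ))` and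
`η ↦ η_P`, over `(p, q, r) ↦ (p, r)`. -/
def transH : Transl boxSig proSig (fun d => (d.1, d.2.2)) where
  tm
    | .C n _ p _ _ => ProTerm.P (.var none rfl)
        (ProTerm.iterM n p fun i => .var (some i) rfl) rfl
    | .unit => ProTerm.etaP
  linear
    | .C n _ p a b => ProTerm.linear_C n p a b _ rfl fun _ => rfl
    | .unit => ⟨Multiset.nodup_zero, fun i => i.elim⟩

theorem Cong.of {C : Type} {S : Sig C} {R : Relations S} {ι : Type} {c : ι → C} {d : C}
    {s t : Tm S ι c d} (h : R ι c d s t) : Cong R s t := by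
  simpa only [Tm.subst_var] using Cong.rel h fun i => .var i rfl

section V

variable {ι : Type} {c : ι → ℕ × ℕ × ℕ}

theorem trV_C {d : ℕ × ℕ × ℕ} (n : ℕ) (q : Fin n → ℕ) (p : Fin (n + 1) → ℕ) (a b : ℕ)
    (x : Tm boxSig ι c (a, n, b)) (y : ∀ i : Fin n, Tm boxSig ι c (p i.castSucc, q i, p i.succ))
    (h : (a + p 0, ∑ i, q i, b + p (Fin.last n)) = d) :
    (BoxTerm.C n q p a b x y h).tr transV =
      OpTerm.C n q (x.tr transV) (fun i => (y i).tr transV) (congrArg (fun d => d.2.1) h) := by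
  subst h
  refine (Tm.cast_rfl _).trans ((OpTerm.subst_C n q _ _ _ _).trans ?_)
  exact OpTerm.C_congr n q _ (Tm.cast_rfl _) fun i => Tm.cast_rfl _

theorem trV_unit : (BoxTerm.unit : Tm boxSig ι c _).tr transV = OpTerm.unit :=
  congrArg (fun a => Tm.op (S := opSig) .unit a rfl) (funext fun j => j.elim)

theorem transV_rel : ∀ κ k d s t, BoxRel κ k d s t → Cong OpRel (s.tr transV) (t.tr transV) := by
  rintro κ k d s t (⟨n, m, p, a, b, q, s, x, y, z⟩ | ⟨p, n, r, x⟩ | ⟨p, n, r, x⟩)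
  · have h := OpRel.assoc n m q (x.tr transV) (fun i => (y i).tr transV) fun j => (z j).tr transV
    refine Eq.mpr (congrArg₂ (Cong OpRel) ?_ ?_) (Cong.of h)
    · exact (trV_C ..).trans (OpTerm.C_congr _ _ _ (trV_C ..) fun _ => rfl)
    · exact (trV_C ..).trans (OpTerm.C_congr _ _ _ rfl fun _ => trV_C ..)
  · have h := OpRel.unit_left n (x.tr transV)
    refine Eq.mpr (congrArg₂ (Cong OpRel) ?_ rfl) (Cong.of h)
    exact (trV_C ..).trans (OpTerm.C_congr _ _ _ trV_unit fun i => by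
      obtain rfl := Subsingleton.elim i 0; rfl)
  · have h := OpRel.unit_right n (x.tr transV)
    refine Eq.mpr (congrArg₂ (Cong OpRel) ?_ rfl) (Cong.of h)
    exact (trV_C ..).trans (OpTerm.C_congr _ _ _ rfl fun _ => trV_unit)

end V

theorem Cong.of_eq {C : Type} {S : Sig C} {R : Relations S} {ι : Type} {c : ι → C} {d : C}
    {s t : Tm S ι c d} (h : s = t) : Cong R s t := h ▸ .refl s

namespace ProTerm

variable {ι : Type} {c : ι → ℕ × ℕ}

theorem M_congr {p r t : ℕ} {x x' : Tm proSig ι c (p, r)} {y y' : Tm proSig ι c (r, t)}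
    (hx : Cong ProRel x x') (hy : Cong ProRel y y') : Cong ProRel (M x y) (M x' y') :=
  .op (S := proSig) (ProGen.M p r t) _ _ rfl fun j => match j with
    | (0 : Fin 2) => hx
    | (1 : Fin 2) => hy

theorem P_congr {p r p' r' : ℕ} {d : ℕ × ℕ} {x x' : Tm proSig ι c (p, r)}
    {y y' : Tm proSig ι c (p', r')} (h : (p + p', r + r') = d)
    (hx : Cong ProRel x x') (hy : Cong ProRel y y') : Cong ProRel (P x y h) (P x' y' h) :=
  .op (S := proSig) (ProGen.P p r p' r') _ _ h fun j => match j with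
    | (0 : Fin 2) => hx
    | (1 : Fin 2) => hy

theorem assoc_P {p r p' r' p'' r'' : ℕ} {d : ℕ × ℕ} (x : Tm proSig ι c (p, r))
    (y : Tm proSig ι c (p', r')) (z : Tm proSig ι c (p'', r'')) (h₁ : (p + p' + p'', r + r' + r'') = d)
    (h₂ : (p + (p' + p''), r + (r' + r'')) = d) :
    Cong ProRel (P (P x y rfl) z h₁) (P x (P y z rfl) h₂) := by
  subst h₁
  exact .of (.assoc_P x y z)

theorem ident_add (a b : ℕ) :
    Cong ProRel (P (ident a) (ident b) rfl : Tm proSig ι c _) (ident (a + b)) := by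
  induction b with
  | zero => exact .of (.unit_P_right _)
  | succ b ih => exact (assoc_P (ident a) (ident b) etaM rfl rfl).symm.trans (P_congr _ ih (.refl _))

theorem iterM_congr (n : ℕ) (p : Fin (n + 1) → ℕ)
    {y y' : ∀ i : Fin n, Tm proSig ι c (p i.castSucc, p i.succ)}
    (h : ∀ i, Cong ProRel (y i) (y' i)) : Cong ProRel (iterM n p y) (iterM n p y') := by
  induction n with
  | zero => exact .refl _
  | succ n ih => exact M_congr (ih _ fun i => h i.castSucc) (h _)

theorem iterM_P (n : ℕ) (p p' : Fin (n + 1) → ℕ)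
    (y : ∀ i : Fin n, Tm proSig ι c (p i.castSucc, p i.succ))
    (y' : ∀ i : Fin n, Tm proSig ι c (p' i.castSucc, p' i.succ)) :
    Cong ProRel (iterM n (fun i => p i + p' i) fun i => P (y i) (y' i) rfl)
      (P (iterM n p y) (iterM n p' y') rfl) := by
  induction n with
  | zero => exact (ident_add _ _).symm
  | succ n ih => exact (M_congr (ih _ _ _ _) (.refl _)).trans (.of (.interchange _ _ _ _))

theorem iterM_append {N : ℕ} (s : Fin (N + 1) → ℕ)
    (z : ∀ j : Fin N, Tm proSig ι c (s j.castSucc, s j.succ)) (a l b : ℕ) (h : a + l = b)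
    (hb : b ≤ N) :
    Cong ProRel (M
      (iterM a (fun j => s ⟨j.val, by omega⟩) fun j => z ⟨j.val, by omega⟩)
      ((iterM l (fun j => s ⟨a + j.val, by omega⟩) fun j => z ⟨a + j.val, by omega⟩).cast
        (d' := (s ⟨a, by omega⟩, s ⟨b, by omega⟩)) (by subst h; rfl)))
      (iterM b (fun j => s ⟨j.val, by omega⟩) fun j => z ⟨j.val, by omega⟩) := by
  subst h
  refine (M_congr (.refl _) (Cong.of_eq (Tm.cast_rfl _))).trans ?_
  induction l with
  | zero => exact .of (.unit_M_right _)
  | succ l ih =>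
    exact (Cong.of (.assoc_M _ _ _)).symm.trans (M_congr (ih (by omega)) (.refl _))

theorem iterM_blocks {N : ℕ} (s : Fin (N + 1) → ℕ)
    (z : ∀ j : Fin N, Tm proSig ι c (s j.castSucc, s j.succ)) (n : ℕ) (st : Fin (n + 1) → ℕ)
    (m : Fin n → ℕ) (hN : ∀ i, st i ≤ N) (h₀ : st 0 = 0)
    (h : ∀ i : Fin n, st i.castSucc + m i = st i.succ)
    (hm : ∀ i : Fin n, st i.castSucc + m i ≤ N) :
    Cong ProRel
      (iterM n (fun i => s ⟨st i, by have := hN i; omega⟩) fun i =>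
        (iterM (m i) (fun j => s ⟨st i.castSucc + j.val, by have := hm i; omega⟩)
          fun j => z ⟨st i.castSucc + j.val, by have := hm i; omega⟩).cast
          (d' := (s ⟨st i.castSucc, by have := hN i.castSucc; omega⟩,
            s ⟨st i.succ, by have := hN i.succ; omega⟩)) (by simp only [← h i]; rfl))
      ((iterM (st (Fin.last n)) (fun j => s ⟨j.val, by have := hN (Fin.last n); omega⟩)
        fun j => z ⟨j.val, by have := hN (Fin.last n); omega⟩).cast
        (d' := (s ⟨st 0, by have := hN 0; omega⟩,
          s ⟨st (Fin.last n), by have := hN (Fin.last n); omega⟩)) (by simp only [h₀]; rfl)) := by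
  induction n with
  | zero =>
    have key : ∀ (k : ℕ) (hk : k = 0) (hkN : k ≤ N), Cong ProRel
        (ident (s ⟨k, by omega⟩) : Tm proSig ι c (s ⟨k, by omega⟩, s ⟨k, by omega⟩))
        ((iterM k (fun j => s ⟨j.val, by omega⟩) fun j => z ⟨j.val, by omega⟩).cast
          (d' := (s ⟨k, by omega⟩, s ⟨k, by omega⟩)) (by subst hk; rfl)) := by
      intro k hk hkN
      subst hk
      exact .of_eq (Tm.cast_rfl _).symm
    exact key _ h₀ (hN 0)
  | succ n ih =>
    refine (M_congr (ih (fun i => st i.castSucc) (fun i => m i.castSucc) (fun i => hN _) h₀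
      (fun i => h _) (fun i => hm _)) (.refl _)).trans ?_
    have key : ∀ (k a l b : ℕ) (hk : k = 0) (hl : a + l = b) (hb : b ≤ N), Cong ProRel
        (M ((iterM a (fun j => s ⟨j.val, by omega⟩) fun j => z ⟨j.val, by omega⟩).cast
          (d' := (s ⟨k, by omega⟩, s ⟨a, by omega⟩)) (by subst hk; rfl))
        ((iterM l (fun j => s ⟨a + j.val, by omega⟩) fun j => z ⟨a + j.val, by omega⟩).cast
          (d' := (s ⟨a, by omega⟩, s ⟨b, by omega⟩)) (by subst hl; rfl)))
        ((iterM b (fun j => s ⟨j.val, by omega⟩) fun j => z ⟨j.val, by omega⟩).cast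
          (d' := (s ⟨k, by omega⟩, s ⟨b, by omega⟩)) (by subst hk; rfl)) := by
      intro k a l b hk hl hb
      subst hk
      exact (M_congr (.of_eq (Tm.cast_rfl _)) (.refl _)).trans
        ((iterM_append s z a l b hl hb).trans (.of_eq (Tm.cast_rfl _).symm))
    exact key (st 0) (st (Fin.last n).castSucc) (m (Fin.last n)) (st (Fin.last (n + 1))) h₀
      (h (Fin.last n)) (hN _)

theorem P_cast {p r p' r' u v : ℕ} {d : ℕ × ℕ} (x : Tm proSig ι c (p, r))
    (y : Tm proSig ι c (p', r')) (h : (p + p', r + r') = d) (e : (p', r') = (u, v))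
    (h' : (p + u, r + v) = d) : P x y h = P x (y.cast e) h' := by
  cases e
  rw [Tm.cast_rfl]

theorem P_P_cast {p r p' r' p'' r'' u v : ℕ} {d : ℕ × ℕ} (x : Tm proSig ι c (p, r))
    (y : Tm proSig ι c (p', r')) (z : Tm proSig ι c (p'', r'')) (e : (p'', r'') = (u, v))
    (h : (p + (p' + p''), r + (r' + r'')) = d) (h' : (p + (p' + u), r + (r' + v)) = d) :
    P x (P y z rfl) h = P x (P y (z.cast e) rfl) h' := by
  cases e
  rw [Tm.cast_rfl]

theorem iterM_blk {n : ℕ} (m : Fin n → ℕ) (s : Fin (∑ i, m i + 1) → ℕ)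
    (z : ∀ j : Fin (∑ i, m i), Tm proSig ι c (s j.castSucc, s j.succ)) :
    Cong ProRel
      (iterM n (fun i => s (Blk.start m i)) fun i =>
        (iterM (m i) (fun j => s (Blk.bdry m i j)) fun j => z (Blk.idx m i j)).cast
          (d' := (s (Blk.start m i.castSucc), s (Blk.start m i.succ)))
          (by rw [Blk.bdry_zero, Blk.bdry_last]))
      ((iterM (∑ i, m i) s z).cast (d' := (s (Blk.start m 0), s (Blk.start m (Fin.last n))))
        (by rw [Blk.start_zero, Blk.start_last])) := by
  have h := iterM_blocks s z n (fun i => Blk.off m i.val) m (fun _ => Blk.off_le m _)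
    (Blk.off_zero m) (fun i => (Blk.off_succ m i).symm) (Blk.off_add_le m)
  refine h.trans (.of_eq ?_)
  have key : ∀ (a b : ℕ) (ha : a = 0) (hb : b = ∑ i, m i),
      (iterM b (fun j => s ⟨j.val, by omega⟩) fun j => z ⟨j.val, by omega⟩).cast
        (d' := (s ⟨a, by omega⟩, s ⟨b, by omega⟩)) (by subst ha; rfl) =
      (iterM (∑ i, m i) s z).cast (d' := (s ⟨a, by omega⟩, s ⟨b, by omega⟩))
        (by subst ha hb; rfl) := by
    intro a b ha hb
    subst ha hb
    rfl
  exact key _ _ (Blk.off_zero m) (Blk.off_last m)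

end ProTerm

section H

variable {ι : Type} {c : ι → ℕ × ℕ × ℕ}

theorem trH_C {d : ℕ × ℕ × ℕ} (n : ℕ) (q : Fin n → ℕ) (p : Fin (n + 1) → ℕ) (a b : ℕ)
    (x : Tm boxSig ι c (a, n, b)) (y : ∀ i : Fin n, Tm boxSig ι c (p i.castSucc, q i, p i.succ))
    (h : (a + p 0, ∑ i, q i, b + p (Fin.last n)) = d) :
    (BoxTerm.C n q p a b x y h).tr transH =
      ProTerm.P (x.tr transH) (ProTerm.iterM n p fun i => (y i).tr transH)
        (congrArg (fun d => (d.1, d.2.2)) h) := by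
  subst h
  refine (Tm.cast_rfl _).trans ((ProTerm.subst_P _ _ _ _).trans ?_)
  refine congrArg₂ (fun a b => ProTerm.P a b _) (Tm.cast_rfl _) ?_
  refine (ProTerm.subst_iterM _ _ _ _).trans (congrArg _ (funext fun i => Tm.cast_rfl _))

theorem trH_unit : (BoxTerm.unit : Tm boxSig ι c _).tr transH = ProTerm.etaP :=
  congrArg (fun a => Tm.op (S := proSig) .etaP a rfl) (funext fun j => j.elim)

theorem transH_rel : ∀ κ k d s t, BoxRel κ k d s t → Cong ProRel (s.tr transH) (t.tr transH) := by
  rintro κ k d s t (⟨n, m, p, a, b, q, s, x, y, z⟩ | ⟨p, n, r, x⟩ | ⟨p, n, r, x⟩)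
  · refine (Cong.of_eq (trH_C ..)).trans ?_
    refine Cong.trans ?_ (Cong.of_eq (trH_C ..)).symm
    refine (ProTerm.P_congr _ (.of_eq (trH_C ..)) (.refl _)).trans ?_
    refine (ProTerm.assoc_P (x.tr transH) (ProTerm.iterM n p fun i => (y i).tr transH)
      (ProTerm.iterM _ s fun i => (z i).tr transH) _ (by simp only [add_assoc])).trans ?_
    refine (Cong.of_eq (ProTerm.P_P_cast _ _ _
      (show _ = (s (Blk.start m 0), s (Blk.start m (Fin.last n))) by
        rw [Blk.start_zero, Blk.start_last]) _
      (by rw [Blk.start_zero, Blk.start_last]; simp only [add_assoc]))).trans ?_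
    refine ProTerm.P_congr _ (.refl _) ?_
    refine (ProTerm.P_congr _ (.refl _) (ProTerm.iterM_blk m s fun i => (z i).tr transH).symm).trans ?_
    refine (ProTerm.iterM_P n p (fun i => s (Blk.start m i)) _ _).symm.trans ?_
    refine ProTerm.iterM_congr _ _ fun i => .of_eq ?_
    refine Eq.symm (Eq.trans (trH_C (m i) (fun j => q (Blk.idx m i j))
      (fun j => s (Blk.bdry m i j)) (p i.castSucc) (p i.succ) (y i)
      (fun j => z (Blk.idx m i j)) _) ?_)
    exact ProTerm.P_cast _ _ _ (by rw [Blk.bdry_zero, Blk.bdry_last]) _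
  · refine (Cong.of_eq (trH_C ..)).trans ?_
    refine (ProTerm.P_congr _ (.of_eq trH_unit) (.of (.unit_M_left _))).trans ?_
    exact .of (.unit_P_left _)
  · refine (Cong.of_eq (trH_C ..)).trans ?_
    refine (ProTerm.P_congr _ (.refl _) (ProTerm.iterM_congr _ _ fun _ => .of_eq trH_unit)).trans ?_
    have key : ∀ n, Cong ProRel
        (ProTerm.iterM n (fun _ => 0) (fun _ => ProTerm.etaP) :
          Tm proSig κ (fun i => ((k i).1, (k i).2.2)) _)
        ProTerm.etaP := by
      intro n
      induction n with
      | zero => exact .refl _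
      | succ n ih => exact (ProTerm.M_congr ih (.refl _)).trans (.of (.unit_M_right _))
    exact (ProTerm.P_congr _ (.refl _) (key n)).trans (.of (.unit_P_right _))

end H

/-- The morphism `V : □p → Op`, determined on generators by `transV`. -/
noncomputable def morphismV : ColOperad.Morphism BoxOperad OpOperad :=
  transV.morphism BoxRel OpRel transV_rel

/-- The morphism `H : □p → Pro`, determined on generators by `transH`. -/
noncomputable def morphismH : ColOperad.Morphism BoxOperad ProOperad :=
  transH.morphism BoxRel ProRel transH_rel

/-! Already `V` is injective on operations with fixed input and output colours; `H` is needed only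
to separate colours. Take a tree of generators of the box operad whose labelled inputs have known
colours. Apart from these colours, the generators of `Op` forget only the boundary colours on
internal edges. In a composite `C(x; y₁, …, yₙ)` with `x` of colour `(a, n, b)`, the left colour `a
+ p₀` of the output determines `p₀`. So the left colour of `y₁` is known; once `y₁` is known, its
right colour `p₁` is the left colour of `y₂`, and so on. The left colour of the root thus propagates
through the whole tree.

Since terms of `Op` are only considered up to its relations, this reconstruction must be invariant
under them. Algebras of `Op` are nonsymmetric operads, and one of them is the endomorphism operad of
a set `W`, with the maps `W^n → W` in colour `n`. Hence `OpTerm.eval` is invariant under congruence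
(`OpTerm.eval_congr`). For `W` take the partial elements `BoxTerm.Val`: predicates relating a left
colour to box terms. A variable acts by formal composition (`nodeVal`), which searches for
compatible boundary colours.

Two facts finish the argument. Evaluating the image of `x` at inputs that all equal the unit yields
a partial element containing `x` itself, because `x = C(x; η, …, η)` (`eval_tr`). Evaluation also
preserves the property of having at most one element, up to congruence, for each left colour
(`unique_eval`). If the images of `s` and `t` are congruent, then `s` and `t` lie in the same
partial element at the same left colour, so they are congruent (`cong_of_tr`). -/

/-! ### Positions in iterated concatenations of blocks. -/

namespace Blk

variable {n : ℕ} (m : Fin n → ℕ) (q : Fin (∑ i, m i) → ℕ)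

/-- Raising `j` by one passes exactly one block of `q`, namely the one at position `idx m i j`, so
both sides grow by the same amount. -/
theorem off_add (i : Fin n) (j : ℕ) (hj : j ≤ m i) :
    off q (off m i + j) = off q (off m i) + off (fun j => q (idx m i j)) j := by
  induction j with
  | zero => rw [off_zero, add_zero, add_zero]
  | succ j ih =>
    have h₁ := off_succ q (idx m i ⟨j, hj⟩)
    have h₂ := off_succ (fun j => q (idx m i j)) ⟨j, hj⟩
    have h₃ := ih (by omega)
    simp only [idx] at h₁ h₂ h₃ ⊢
    rw [← add_assoc, h₁, h₂, h₃, add_assoc]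

/-- Passing a whole block of `m` is the case `j = m i` of `off_add`; it adds the total of the `q`'s
in that block, which is one step of the right-hand side. -/
theorem off_off (k : ℕ) (hk : k ≤ n) :
    off q (off m k) = off (fun i => ∑ j, q (idx m i j)) k := by
  induction k with
  | zero => simp only [off_zero]
  | succ k ih =>
    have h₁ := off_succ m ⟨k, hk⟩
    have h₂ := off_succ (fun i => ∑ j, q (idx m i j)) ⟨k, hk⟩
    have h₃ := off_add m q ⟨k, hk⟩ _ le_rfl
    rw [off_last] at h₃
    simp only at h₁ h₂ h₃
    rw [h₁, h₂, h₃, ih (by omega)]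

/-- Blocks of blocks: the two ways to locate an element agree. -/
theorem idx_idx (i : Fin n) (j : Fin (m i)) (k : Fin (q (idx m i j))) :
    idx q (idx m i j) k = Fin.cast (sum_idx m q)
      (idx (fun i => ∑ j, q (idx m i j)) i (idx (fun j => q (idx m i j)) j k)) := by
  refine Fin.ext ?_
  have h₁ := off_add m q i j j.isLt.le
  have h₂ := off_off m q i i.isLt.le
  change off q (off m i + j) + k.val = off _ i + (off _ j + k.val)
  rw [h₁, h₂, add_assoc]

end Blk

/-! ### Endomorphism operads as algebras of `Op`. -/

namespace OpTerm

variable {ι κ W : Type} {c : ι → ℕ} {k : κ → ℕ}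

/-- The value of a term in the operad of maps `(Fin n → W) → W`. -/
def eval (v : ∀ i, (Fin (c i) → W) → W) : ∀ {d : ℕ}, Tm opSig ι c d → (Fin d → W) → W
  | _, .var i h, w => v i fun j => w (Fin.cast h j)
  | _, .op (.C _ q) args h, w => eval v (args none) fun i =>
      eval v (args (some i)) fun j => w (Fin.cast h (Blk.idx q i j))
  | _, .op .unit _ h, w => w (Fin.cast h (0 : Fin 1))

theorem eval_cast (v : ∀ i, (Fin (c i) → W) → W) {d d' : ℕ} (h : d = d') (t : Tm opSig ι c d)
    (w : Fin d' → W) : eval v (t.cast h) w = eval v t fun j => w (Fin.cast h j) := by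
  subst h
  rw [Tm.cast_rfl]
  rfl

theorem eval_C (v : ∀ i, (Fin (c i) → W) → W) {d n : ℕ} (q : Fin n → ℕ) (x : Tm opSig ι c n)
    (y : ∀ i, Tm opSig ι c (q i)) (h : ∑ i, q i = d) (w : Fin d → W) :
    eval v (C n q x y h) w =
      eval v x fun i => eval v (y i) fun j => w (Fin.cast h (Blk.idx q i j)) := rfl

/-- Substitution is evaluation at a new valuation. This reduces a substituted instance of a relation
to the relation itself under another valuation. -/
theorem eval_subst (v : ∀ i, (Fin (k i) → W) → W) {d : ℕ} (t : Tm opSig ι c d)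
    (u : ∀ i, Tm opSig κ k (c i)) (w : Fin d → W) :
    eval v (t.subst u) w = eval (fun i => eval v (u i)) t w := by
  induction t with
  | var i h => exact eval_cast v h _ w
  | op g args h ih =>
    cases g with
    | C n q =>
      refine (ih none _).trans (congrArg (eval _ (args none)) (funext fun i => ?_))
      exact ih (some i) _
    | unit => rfl

/-- Composition of maps is associative and unital, so only the bookkeeping of input positions
remains. For associativity this is `Blk.idx_idx`. -/
theorem eval_rel (v : ∀ i, (Fin (c i) → W) → W) {d : ℕ} {s t : Tm opSig ι c d}
    (h : OpRel ι c d s t) : eval v s = eval v t := by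
  funext w
  cases h with
  | assoc n m q x y z =>
    refine congrArg (eval v x) (funext fun i => congrArg (eval v (y i)) (funext fun j => ?_))
    exact congrArg (eval v (z _)) (funext fun k => congrArg w (Blk.idx_idx m q i j k))
  | unit_left =>
    refine (eval_C ..).trans ?_
    change eval v t _ = _
    refine congrArg (eval v t) (funext fun j => congrArg w (Fin.ext ?_))
    simp [Blk.idx, Blk.off]
  | unit_right =>
    refine (eval_C ..).trans ?_
    refine congrArg (eval v t) (funext fun j => ?_)
    change w _ = _
    refine congrArg w (Fin.ext ?_)
    have := (Fin.card_filter_val_lt (n := d) (m := j.val)).trans (min_eq_right j.isLt.le)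
    simpa [Blk.idx, Blk.off] using this

theorem eval_congr (v : ∀ i, (Fin (c i) → W) → W) {d : ℕ} {s t : Tm opSig ι c d}
    (h : Cong OpRel s t) : eval v s = eval v t := by
  induction h with
  | rel h u =>
    funext w
    rw [eval_subst, eval_subst, eval_rel _ h]
  | op g x y h _ ih =>
    funext w
    cases g with
    | C n q =>
      refine (congrFun (ih none) _).trans (congrArg (eval v (y none)) (funext fun i => ?_))
      exact congrFun (ih (some i)) _
    | unit => rfl
  | refl t => rfl
  | symm _ ih => exact ih.symm
  | trans _ _ ih ih' => exact ih.trans ih'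

end OpTerm

/-! ### Reconstruction of box terms from their images in `Op`. -/

namespace BoxTerm

variable {ι : Type} {c : ι → ℕ × ℕ × ℕ}

/-- Partial elements of the box operad: for every left colour a set of terms. -/
abbrev Val (c : ι → ℕ × ℕ × ℕ) : Type := ℕ → ∀ d, Tm boxSig ι c d → Prop

/-- Composition of the variable `i` with partial elements. The left colours of the latter are
determined successively, starting from the left colour of the composite. -/
def nodeVal (i : ι) (w : Fin (c i).2.1 → Val c) : Val c := fun l d t =>
  ∃ (q : Fin (c i).2.1 → ℕ) (p : Fin ((c i).2.1 + 1) → ℕ)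
    (h : ((c i).1 + p 0, ∑ j, q j, (c i).2.2 + p (Fin.last _)) = d)
    (y : ∀ j, Tm boxSig ι c (p j.castSucc, q j, p j.succ)),
    -- An arbitrary `w j` need not be closed under congruence, so it is required to contain the
    -- whole congruence class of `y j`.
    l = (c i).1 + p 0 ∧ (∀ j t, Cong BoxRel t (y j) → w j (p j.castSucc) _ t) ∧
      Cong BoxRel t (C (c i).2.1 q p (c i).1 (c i).2.2 (.var i rfl) y h)

/-- The partial element given by the unit. -/
def unitVal : Val c := fun l d t => l = 0 ∧ ∃ h : (0, 1, 0) = d, Cong BoxRel t (unit.cast h)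

/-- For every left colour there is at most one element up to congruence. -/
def Val.Unique (w : Val c) : Prop := ∀ ⦃l d d' t t'⦄, w l d t → w l d' t' →
  ∃ h : d = d', Cong BoxRel (t.cast h) t'

theorem unique_unitVal : (unitVal : Val c).Unique := by
  rintro l d d' t t' ⟨-, rfl, ht⟩ ⟨-, rfl, ht'⟩
  exact ⟨rfl, (ht.cast rfl).trans ((Cong.of_eq (Tm.cast_rfl _)).trans ht'.symm)⟩

theorem C_congr {d : ℕ × ℕ × ℕ} (n : ℕ) (q : Fin n → ℕ) (p : Fin (n + 1) → ℕ) (a b : ℕ)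
    {x x' : Tm boxSig ι c (a, n, b)}
    {y y' : ∀ i : Fin n, Tm boxSig ι c (p i.castSucc, q i, p i.succ)}
    (h : (a + p 0, ∑ i, q i, b + p (Fin.last n)) = d)
    (hx : Cong BoxRel x x') (hy : ∀ i, Cong BoxRel (y i) (y' i)) :
    Cong BoxRel (C n q p a b x y h) (C n q p a b x' y' h) :=
  .op (S := boxSig) (BoxGen.C n q p a b) _ _ h fun j => match j with
    | none => hx
    | some i => hy i

/-- This is where the left colour determines everything: the boundary colours follow one after
another from left to right, then the `q j`, and finally the terms `y j` up to congruence. -/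
theorem unique_nodeVal (i : ι) (w : Fin (c i).2.1 → Val c) (hw : ∀ j, (w j).Unique) :
    (nodeVal i w).Unique := by
  rintro l d d' t t' ⟨q, p, h, y, hl, hy, ht⟩ ⟨q', p', h', y', hl', hy', ht'⟩
  have hp : p = p' := by
    funext j
    -- The equations for `l` give `p 0 = p' 0`. If the `j`-th boundaries agree, both candidates for
    -- the `j`-th input have the same left colour in `w j`, so uniqueness gives the same right
    -- colour, which is the next boundary.
    induction j using Fin.induction with
    | zero => omega
    | succ j ih =>
      -- The left colour is an index of `w j` separate from the colour of the term, so it can be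
      -- rewritten without transporting `y j`.
      have h₁ := (congrArg (fun l => w j l _ (y j)) ih).mp (hy j _ (.refl _))
      exact congrArg (fun d => d.2.2) (hw j h₁ (hy' j _ (.refl _))).1
  subst hp
  have hq : q = q' := funext fun j =>
    congrArg (fun d => d.2.1) (hw j (hy j _ (.refl _)) (hy' j _ (.refl _))).1
  subst hq h h'
  refine ⟨rfl, (Cong.of_eq (Tm.cast_rfl _)).trans (ht.trans (.trans ?_ ht'.symm))⟩
  refine C_congr _ _ _ _ _ rfl (.refl _) fun j => ?_
  obtain ⟨_, hj⟩ := hw j (hy j _ (.refl _)) (hy' j _ (.refl _))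
  exact (Cong.of_eq (Tm.cast_rfl _).symm).trans hj

/-- Variables preserve uniqueness by `unique_nodeVal`, and the generators of `Op` only nest
evaluations or return an input, so the property passes through the tree. -/
theorem unique_eval {d : ℕ} (t : Tm opSig ι (fun i => (c i).2.1) d) (w : Fin d → Val c)
    (hw : ∀ j, (w j).Unique) : (OpTerm.eval nodeVal t w).Unique := by
  induction t with
  | var i h => exact unique_nodeVal i _ fun j => hw _
  | op g args h ih =>
    cases g with
    | C n q => exact ih none _ fun i => ih (some i) _ fun j => hw _
    | unit => exact hw _

/-- An argument family agrees with its split into `none` and `some i` only after a case distinction.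
This brings a node into the form to which `trV_C` and the associativity relation apply. -/
theorem op_C {d : ℕ × ℕ × ℕ} (n : ℕ) (q : Fin n → ℕ) (p : Fin (n + 1) → ℕ) (a b : ℕ)
    (args : ∀ j, Tm boxSig ι c (boxSig.inp (.C n q p a b) j))
    (h : boxSig.out (.C n q p a b) = d) :
    Tm.op (S := boxSig) (.C n q p a b) args h =
      C n q p a b (args none) (fun i => args (some i)) h := by
  refine congrArg (fun a' => Tm.op (S := boxSig) (.C n q p a b) a' h) (funext fun j => ?_)
  cases j <;> rfl

theorem op_unit (args : ∀ j, Tm boxSig ι c (boxSig.inp .unit j)) :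
    Tm.op (S := boxSig) .unit args rfl = unit :=
  congrArg (fun a => Tm.op (S := boxSig) .unit a rfl) (funext fun j => j.elim)

/-- The relation `unit_left` is stated for boundary families `![p, r]` and constant `q`, and all
families on `Fin 2` and `Fin 1` have this form. The cast absorbs the sums in the output colour. -/
theorem C_unit {d : ℕ × ℕ × ℕ} (q : Fin 1 → ℕ) (p : Fin 2 → ℕ)
    (y : ∀ i : Fin 1, Tm boxSig ι c (p i.castSucc, q i, p i.succ))
    (h : (0 + p 0, ∑ i, q i, 0 + p (Fin.last 1)) = d) (h' : (p 0, q 0, p 1) = d) :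
    Cong BoxRel (C 1 q p 0 0 unit y h) (Tm.cast h' (y 0)) := by
  subst h'
  obtain ⟨p₀, p₁, rfl⟩ : ∃ p₀ p₁, p = ![p₀, p₁] := ⟨p 0, p 1, by ext i; fin_cases i <;> rfl⟩
  obtain ⟨n, rfl⟩ : ∃ n, q = fun _ => n := ⟨q 0, by ext i; fin_cases i; rfl⟩
  refine .trans ?_ ((Cong.of (.unit_left p₀ n p₁ (y 0))).trans (.of_eq (Tm.cast_rfl _).symm))
  refine C_congr _ _ _ _ _ _ (.refl _) fun i => ?_
  obtain rfl := Subsingleton.elim i 0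
  exact .refl _

/-- Base case of `eval_tr`: evaluating `η` returns `w 0`, and the left unit law identifies `C(η; y)`
with `y 0`. -/
theorem eval_tr_unit (w : Fin 1 → Val c) (q : Fin 1 → ℕ) (p : Fin 2 → ℕ)
    (y : ∀ j : Fin 1, Tm boxSig ι c (p j.castSucc, q j, p j.succ))
    (hy : ∀ j t, Cong BoxRel t (y j) → w j (p j.castSucc) _ t)
    (l : ℕ) (hl : l = 0 + p 0) (d : ℕ × ℕ × ℕ)
    (h : (0 + p 0, ∑ j, q j, 0 + p (Fin.last _)) = d) (t : Tm boxSig ι c d)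
    (ht : Cong BoxRel t (C 1 q p 0 0 unit y h)) :
    OpTerm.eval nodeVal ((unit : Tm boxSig ι c _).tr transV) w l d t := by
  have h' : (p 0, q 0, p 1) = d := by
    rw [← h]
    simp
  subst h'
  obtain rfl : l = p 0 := by simpa using hl
  rw [trV_unit]
  exact hy 0 t (ht.trans ((C_unit q p y h rfl).trans (.of_eq (Tm.cast_rfl _))))

/-- The composite of `x` with elements `y j` of the partial elements `w j` is an element of the
value of `x` at `w`. -/
theorem eval_tr {D : ℕ × ℕ × ℕ} (x : Tm boxSig ι c D) (w : Fin D.2.1 → Val c)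
    (q : Fin D.2.1 → ℕ) (p : Fin (D.2.1 + 1) → ℕ)
    (y : ∀ j, Tm boxSig ι c (p j.castSucc, q j, p j.succ))
    (hy : ∀ j t, Cong BoxRel t (y j) → w j (p j.castSucc) _ t)
    (l : ℕ) (hl : l = D.1 + p 0) (d : ℕ × ℕ × ℕ)
    (h : (D.1 + p 0, ∑ j, q j, D.2.2 + p (Fin.last _)) = d) (t : Tm boxSig ι c d)
    (ht : Cong BoxRel t (C D.2.1 q p D.1 D.2.2 x y h)) :
    OpTerm.eval nodeVal (x.tr transV) w l d t := by
  induction x generalizing l d with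
  | var i hi =>
    subst hi
    exact ⟨q, p, h, y, hl, hy, ht⟩
  | op g args hg ih =>
    subst hg
    cases g with
    | unit =>
      rw [op_unit] at ht ⊢
      exact eval_tr_unit w q p y hy l hl d h t ht
    | C n m r a b =>
      rw [op_C] at ht ⊢
      subst h hl
      refine Eq.mpr (congrArg (fun s => OpTerm.eval nodeVal s w _ _ t) (trV_C ..)) ?_
      -- Associativity turns `C(C(x; x₁, …, xₙ); y)` into `C(x; C(x₁; …), …, C(xₙ; …))`. The
      -- induction hypothesis for `x` handles the outer composite, with the boundaries `r i + p
      -- (start i)` dictated by the relation, and those for the `xᵢ` show that the inner composites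
      -- lie in the evaluated inputs.
      refine ih none _ (fun i => ∑ j, q (Blk.idx m i j)) (fun i => r i + p (Blk.start m i))
        (fun i => C (m i) (fun j => q (Blk.idx m i j)) (fun j => p (Blk.bdry m i j))
          (r i.castSucc) (r i.succ) (args (some i)) (fun j => y (Blk.idx m i j))
          (congrArg₂ (fun u v => (r i.castSucc + p u, ∑ j, q (Blk.idx m i j), r i.succ + p v))
            (Blk.bdry_zero m i) (Blk.bdry_last m i))) (fun i t' ht' => ?_) _ ?_ _ _ _
        (ht.trans (.of (.assoc n m r a b q p (args none) (fun i => args (some i)) y)))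
      -- The left colour is a free variable in the induction because a block's first boundary and
      -- its start are equal only by a proof, `Blk.bdry_zero`.
      · exact ih (some i) _ _ (fun j => p (Blk.bdry m i j)) _ (fun j => hy (Blk.idx m i j)) _
          (congrArg (fun u => r i.castSucc + p u) (Blk.bdry_zero m i).symm) _ _ _ ht'
      · exact (add_assoc _ _ _).trans
          (congrArg (fun u => a + (r 0 + p u)) (Blk.start_zero m).symm)

theorem cong_of_tr {d : ℕ × ℕ × ℕ} {s t : Tm boxSig ι c d}
    (h : Cong OpRel (s.tr transV) (t.tr transV)) : Cong BoxRel s t := by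
  -- Feed units into all inputs: by the right unit law `x` is congruent to `C(x; η, …, η)` with all
  -- boundary colours `0`, so its left colour remains `d.1`.
  have key (x : Tm boxSig ι c d) :
      OpTerm.eval nodeVal (x.tr transV) (fun _ => unitVal) d.1 d x :=
    eval_tr x _ (fun _ => 1) (fun _ => 0) (fun _ => unit)
      (fun _ _ h => ⟨rfl, rfl, h.trans (.of_eq (Tm.cast_rfl _).symm)⟩) _ rfl _ (by simp) _
      (Cong.of (.unit_right d.1 d.2.1 d.2.2 x)).symm
  have hs := key s
  -- Now `s` and `t` both lie in the evaluation of the image of `t`, at the left colour `d.1`.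
  rw [OpTerm.eval_congr nodeVal h] at hs
  obtain ⟨_, hst⟩ := unique_eval (t.tr transV) _ (fun _ => unique_unitVal) hs (key t)
  exact (Cong.of_eq (Tm.cast_rfl _).symm).trans hst

end BoxTerm

/-! ### Injectivity of `(V, H)` and its image. -/

theorem app_morphismV_injective (ι : Type) [Finite ι] (c : ι → ℕ × ℕ × ℕ) (d : ℕ × ℕ × ℕ) :
    Function.Injective (morphismV.app : BoxOperad.Hom ι c d → _) := by
  intro f g h
  obtain ⟨s, hs, rfl⟩ := Presented.exists_rep f
  obtain ⟨t, ht, rfl⟩ := Presented.exists_rep g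
  exact Presented.mk_eq (BoxTerm.cong_of_tr (Quotient.exact h))

/-- On colours, `V` retains `q` and `H` retains `(p, r)`; on operations the first component
suffices. -/
theorem isInjective_prod : (morphismV.prod morphismH).IsInjective := by
  refine ⟨fun x y h => ?_, fun ι _ c d f g h => ?_⟩
  · obtain ⟨h₁, h₂⟩ := Prod.ext_iff.1 h
    obtain ⟨h₂, h₃⟩ := Prod.ext_iff.1 h₂
    exact Prod.ext h₂ (Prod.ext h₁ h₃)
  · exact app_morphismV_injective ι c d (congrArg Prod.fst h)

/-- The inverse of `(V, H)` on colours. -/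
def colourInv (d : ℕ × ℕ × ℕ) : ℕ × ℕ × ℕ := (d.2.1, d.1, d.2.2)

/-- The image of `(V, H)`. -/
noncomputable def rangeVH : ColOperad.Suboperad (OpOperad.prod ProOperad) where
  carrier {ι} _ c d := {g | ∃ f : BoxOperad.Hom ι (fun i => colourInv (c i)) (colourInv d),
    (morphismV.prod morphismH).app f = g}
  one_mem d := ⟨BoxOperad.one _, (morphismV.prod morphismH).app_one _⟩
  map_mem := by
    rintro ι ι' _ _ e c d _ ⟨f, rfl⟩
    exact ⟨BoxOperad.map (c := fun i => colourInv (c i)) e f,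
      (morphismV.prod morphismH).app_map (c := fun i => colourInv (c i)) e f⟩
  comp_mem := by
    rintro ι _ κ _ c k d _ x ⟨f, rfl⟩ hx
    -- All preimages are taken over `colourInv`, so the intermediate colours match and the preimages
    -- can be composed.
    choose y hy using hx
    obtain rfl := funext hy
    exact ⟨BoxOperad.comp (k := fun i j => colourInv (k i j)) f y,
      (morphismV.prod morphismH).app_comp (k := fun i j => colourInv (k i j)) f y⟩

theorem mainTheorem3 :
    (morphismV.prod morphismH).IsInjective ∧
      ∃ U : ColOperad.Suboperad (OpOperad.prod ProOperad),
        (morphismV.prod morphismH).IsIsoOnto U :=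
  ⟨isInjective_prod, rangeVH, ⟨isInjective_prod.1, fun d => ⟨colourInv d, rfl⟩⟩,
    fun ι _ c d => ⟨fun f _ => ⟨f, rfl⟩, (isInjective_prod.2 ι c d).injOn,
      fun _ ⟨f, hf⟩ => ⟨f, trivial, hf⟩⟩⟩
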